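/- Let $q$ be a formal variable and $n\ge 1$. Let $\mathcal H_n=\mathcal H_n(q)$ be the Hecke algebra over $\mathbb C(q)$ with generators $T_1,\dots,T_{n-1}$ and relations $T_iT_{i+1}T_i=T_{i+1}T_iT_{i+1}$, $T_iT_j=T_jT_i$ for $|i-j|>1$, and $T_i^2=1+(q-q^{-1})T_i$. Put $y_1=1$, $y_{k+1}=T_k\,y_k\,T_k$ (the Jucys–Murphy elements), and $T_{w_n}=T_1(T_2T_1)\cdots(T_{n-1}T_{n-2}\cdots T_1)$, the element attached to the longest permutation $w_n\in\mathfrak S_n$. Let $\lambda$ be a partition of $n$ and let $\mathcal T$ be a standard $\lambda$-tableau. The $q$-content of a cell in row $i$ and column $j$ is $q^{2(j-i)}$; let $\sigma_k$ be the $q$-content of the cell of $\mathcal T$ occupied by $k$. Let $E_{\mathcal T}\in\mathcal H_n$ be the primitive idempotent associated with $\mathcal T$ by the following inductive rule: $E_{\mathcal T}=1$ for $n=1$, and for $n\ge 2$ $$E_{\mathcal T}=E_{\mathcal U}\,\frac{(y_n-\rho_1)\cdots(y_n-\rho_m)}{(\sigma_n-\rho_1)\cdots(\sigma_n-\rho_m)},$$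 where $\mathcal U$ is obtained from $\mathcal T$ by removing the cell $\alpha$ occupied by $n$, $E_{\mathcal U}\in\mathcal H_{n-1}$ is regarded as an element of $\mathcal H_n$, and $\rho_1,\dots,\rho_m$ are the $q$-contents of all cells, other than $\alpha$, which are addable to the shape of $\mathcal U$. Set $[m]_q=\dfrac{q^m-q^{-m}}{q-q^{-1}}$, and $$f(\lambda)=\prod_{\alpha\in\lambda}\frac{q^{c_\alpha}}{[h_\alpha]_q},$$ where for a cell $\alpha=(i,j)$ of $\lambda$ the content is $c_\alpha=j-i$ and the hook length is $h_\alpha=\lambda_i+\lambda'_j-i-j+1$, with $\lambda'$ the conjugate partition. Finally set $T_i(x,y)=T_i+\dfrac{q-q^{-1}}{x^{-1}y-1}$ and consider the rational function with values in $\mathcal H_n$ $$\Psi(u_1,\dots,u_n)=\prod_{k=1,\dots,n-1}^{\longrightarrow}\Big(T_k(u_1,u_{k+1})\,T_{k-1}(u_2,u_{k+1})\cdots T_1(u_k,u_{k+1})\Big)\cdot T_{w_n}^{-1},$$ in which the factors are ordered from left to right by increasing $k$. Then $E_{\mathcal T}$ is obtained by the consecutive evaluations $$E_{\mathcal T}=f(\lambda)\cdot\Psi(u_1,\dots,u_n)\big|_{u_1=\sigma_1}\big|_{u_2=\sigma_2}\cdots\big|_{u_n=\sigma_n},$$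 where at each step the rational function (in the remaining variables) is regular at the evaluation point. That is, after the evaluations at $u_1=\sigma_1,\dots,u_{k-1}=\sigma_{k-1}$ the resulting rational function of $u_k,\dots,u_n$ is regular at $u_k=\sigma_k$ for generic $u_{k+1},\dots,u_n$. -/

import Mathlib

open scoped TensorProduct

noncomputable section

namespace HeckeFusion

/-- The field `ℂ(q)` of rational functions in a formal variable `q`. -/
abbrev Kq : Type := RatFunc ℂ

/-- The formal variable `q`. -/
def q : Kq := RatFunc.X

/-! ### The Hecke algebra -/

/-- The indices `1, …, n - 1` of the generators of the Hecke algebra. -/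
abbrev GenIndex (n : ℕ) : Type := {i : ℕ // 1 ≤ i ∧ i < n}

/-- The defining relations of the Hecke algebra. -/
inductive HeckeRel (n : ℕ) :
    FreeAlgebra Kq (GenIndex n) → FreeAlgebra Kq (GenIndex n) → Prop
  | braid (i j : GenIndex n) (h : j.1 = i.1 + 1) :
      HeckeRel n
        (FreeAlgebra.ι Kq i * FreeAlgebra.ι Kq j * FreeAlgebra.ι Kq i)
        (FreeAlgebra.ι Kq j * FreeAlgebra.ι Kq i * FreeAlgebra.ι Kq j)
  | comm (i j : GenIndex n) (h : i.1 + 1 < j.1 ∨ j.1 + 1 < i.1) :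
      HeckeRel n
        (FreeAlgebra.ι Kq i * FreeAlgebra.ι Kq j)
        (FreeAlgebra.ι Kq j * FreeAlgebra.ι Kq i)
  | quad (i : GenIndex n) :
      HeckeRel n
        (FreeAlgebra.ι Kq i * FreeAlgebra.ι Kq i)
        (1 + (q - q⁻¹) • FreeAlgebra.ι Kq i)

/-- The Hecke algebra `H_n(q)` over `ℂ(q)`. -/
def Hecke (n : ℕ) : Type := RingQuot (HeckeRel n)

instance (n : ℕ) : Ring (Hecke n) := inferInstanceAs (Ring (RingQuot (HeckeRel n)))

instance (n : ℕ) : Algebra Kq (Hecke n) :=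
  inferInstanceAs (Algebra Kq (RingQuot (HeckeRel n)))

/-- The generator `T_i` of the Hecke algebra. -/
def gen (n : ℕ) (i : GenIndex n) : Hecke n :=
  RingQuot.mkAlgHom Kq (HeckeRel n) (FreeAlgebra.ι Kq i)

theorem gen_mul_gen (n : ℕ) (i : GenIndex n) :
    gen n i * gen n i = 1 + (q - q⁻¹) • gen n i := by
  have h := RingQuot.mkAlgHom_rel Kq (HeckeRel.quad i)
  rw [map_mul, map_add, map_one, map_smul] at h
  exact h

/-- The generator `T_i`, `1 ≤ i < n`, as an invertible element, with inverse
`T_i - (q - q⁻¹)`. For `i` out of range the value is `1`; it is not used. -/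
def T (n i : ℕ) : (Hecke n)ˣ :=
  if h : 1 ≤ i ∧ i < n then
    { val := gen n ⟨i, h⟩
      inv := gen n ⟨i, h⟩ - (q - q⁻¹) • 1
      val_inv := by
        rw [mul_sub, gen_mul_gen, mul_smul_comm, mul_one, add_sub_cancel_right]
      inv_val := by
        rw [sub_mul, gen_mul_gen, smul_mul_assoc, one_mul, add_sub_cancel_right] }
  else 1

/-- The product `T_k T_{k-1} ⋯ T_1`. -/
def descProd (n : ℕ) : ℕ → (Hecke n)ˣ
  | 0 => 1
  | k + 1 => T n (k + 1) * descProd n k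

/-- The element `T_{w_k} = T_1 (T_2 T_1) ⋯ (T_{k-1} T_{k-2} ⋯ T_1)` attached to the longest
element `w_k` of the symmetric group on `k` letters. -/
def Tlong (n : ℕ) : ℕ → (Hecke n)ˣ
  | 0 => 1
  | k + 1 => Tlong n k * descProd n k

/-- The Jucys–Murphy elements: `y_1 = 1` and `y_{k+1} = T_k y_k T_k`
(the value at index `0` is not used). -/
def jm (n : ℕ) : ℕ → Hecke n
  | 0 => 1
  | 1 => 1
  | k + 2 => T n (k + 1) * jm n (k + 1) * T n (k + 1)

/-! ### Young diagrams and standard tableaux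

Rows, columns and entries are counted from `0`, so that the cell in row `i` and column `j`
in the usual notation is `(i - 1, j - 1)`, and the usual entry `k` is `k - 1 : Fin n`. -/

/-- A standard tableau of shape `lam` with `n` cells: a bijective filling of the cells of `lam`
which increases along rows and down columns. Here `cell k` is the cell containing the
`k`-th entry. -/
structure StandardTableau (n : ℕ) (lam : YoungDiagram) where
  cell : Fin n ≃ {c : ℕ × ℕ // c ∈ lam.cells}
  row_lt : ∀ c d : {c : ℕ × ℕ // c ∈ lam.cells},
    c.1.1 = d.1.1 → c.1.2 < d.1.2 → cell.symm c < cell.symm d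
  col_lt : ∀ c d : {c : ℕ × ℕ // c ∈ lam.cells},
    c.1.2 = d.1.2 → c.1.1 < d.1.1 → cell.symm c < cell.symm d

/-- The content `j - i` of a cell. -/
def content (c : ℕ × ℕ) : ℤ := (c.2 : ℤ) - (c.1 : ℤ)

/-- The `q`-content `q^{2(j-i)}` of a cell. -/
def qContent (c : ℕ × ℕ) : Kq := q ^ (2 * content c)

open Classical in
/-- The cells addable to the diagram `mu`: those outside `mu` whose union with `mu` is a
diagram. (The bounds on the coordinates hold automatically, see `mem_addable`.) -/
def addable (mu : YoungDiagram) : Finset (ℕ × ℕ) :=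
  (Finset.range (mu.card + 1) ×ˢ Finset.range (mu.card + 1)).filter
    fun c => c ∉ mu.cells ∧ IsLowerSet (insert c (mu.cells : Set (ℕ × ℕ)))

theorem mem_addable (mu : YoungDiagram) (c : ℕ × ℕ) :
    c ∈ addable mu ↔
      c ∉ mu.cells ∧ IsLowerSet (insert c (mu.cells : Set (ℕ × ℕ))) := by
  classical
  simp only [addable, Finset.mem_filter, Finset.mem_product, Finset.mem_range,
    and_iff_right_iff_imp]
  rintro ⟨-, h⟩
  obtain ⟨i, j⟩ := c
  constructor
  · have hsub : (Finset.range i).image (fun a => (a, j)) ⊆ mu.cells := by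
      intro x hx
      obtain ⟨a, ha, rfl⟩ := Finset.mem_image.1 hx
      have ha := Finset.mem_range.1 ha
      have := h (show ((a, j) : ℕ × ℕ) ≤ (i, j) from ⟨ha.le, le_rfl⟩) (Set.mem_insert _ _)
      rcases this with h1 | h1
      · simp only [Prod.mk.injEq] at h1; omega
      · exact h1
    have h2 := Finset.card_le_card hsub
    rw [Finset.card_image_of_injective _ (fun a b hab => (Prod.mk.inj hab).1),
      Finset.card_range] at h2
    exact Nat.lt_succ_of_le h2
  · have hsub : (Finset.range j).image (fun a => (i, a)) ⊆ mu.cells := by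
      intro x hx
      obtain ⟨a, ha, rfl⟩ := Finset.mem_image.1 hx
      have ha := Finset.mem_range.1 ha
      have := h (show ((i, a) : ℕ × ℕ) ≤ (i, j) from ⟨le_rfl, ha.le⟩) (Set.mem_insert _ _)
      rcases this with h1 | h1
      · simp only [Prod.mk.injEq] at h1; omega
      · exact h1
    have h2 := Finset.card_le_card hsub
    rw [Finset.card_image_of_injective _ (fun a b hab => (Prod.mk.inj hab).2),
      Finset.card_range] at h2
    exact Nat.lt_succ_of_le h2

namespace StandardTableau

variable {n : ℕ} {lam : YoungDiagram}

theorem symm_le_symm (t : StandardTableau n lam) (c d : {c : ℕ × ℕ // c ∈ lam.cells})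
    (h : c.1 ≤ d.1) : t.cell.symm c ≤ t.cell.symm d := by
  obtain ⟨⟨i, j⟩, hc⟩ := c
  obtain ⟨⟨i', j'⟩, hd⟩ := d
  obtain ⟨hi, hj⟩ : i ≤ i' ∧ j ≤ j' := h
  have he : ((i, j') : ℕ × ℕ) ∈ lam.cells :=
    lam.isLowerSet (show ((i, j') : ℕ × ℕ) ≤ (i', j') from ⟨hi, le_rfl⟩) hd
  have h1 : t.cell.symm ⟨(i, j), hc⟩ ≤ t.cell.symm ⟨(i, j'), he⟩ := by
    rcases hj.eq_or_lt with rfl | hlt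
    · exact le_rfl
    · exact (t.row_lt ⟨(i, j), hc⟩ ⟨(i, j'), he⟩ rfl hlt).le
  have h2 : t.cell.symm ⟨(i, j'), he⟩ ≤ t.cell.symm ⟨(i', j'), hd⟩ := by
    rcases hi.eq_or_lt with rfl | hlt
    · exact le_rfl
    · exact (t.col_lt ⟨(i, j'), he⟩ ⟨(i', j'), hd⟩ rfl hlt).le
  exact h1.trans h2

/-- The diagram formed by the cells of the first `k` entries of a standard tableau. -/
def shape (t : StandardTableau n lam) (k : ℕ) : YoungDiagram where
  cells := (Finset.univ.filter fun i : Fin n => i.1 < k).image fun i => (t.cell i).1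
  isLowerSet := by
    intro d c hcd hd
    simp only [Finset.coe_image, Finset.coe_filter, Finset.mem_univ, true_and, Set.mem_image,
      Set.mem_ofPred_eq] at hd ⊢
    obtain ⟨i, hi, rfl⟩ := hd
    have hc : c ∈ lam.cells := lam.isLowerSet hcd (t.cell i).2
    refine ⟨t.cell.symm ⟨c, hc⟩, ?_, by simp⟩
    have h := t.symm_le_symm ⟨c, hc⟩ (t.cell i) hcd
    rw [Equiv.symm_apply_apply] at h
    exact lt_of_le_of_lt h hi

/-- The `q`-content `σ_k` of the cell containing the `k`-th entry. -/
def sigma (t : StandardTableau n lam) (k : Fin n) : Kq := qContent (t.cell k).1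

/-- `idemAux t k` is the idempotent attached to the standard tableau formed by the first `k`
entries of `t`, as an element of `H_n ⊇ H_k`. It is defined inductively: it is `1` at first, and
adding the entry in the cell `α`, in position `k + 1`, multiplies it by the product of the factors
`(y_{k+1} - ρ) / (σ - ρ)`, where `σ` is the `q`-content of `α` and `ρ` runs over the `q`-contents
of the other cells addable to the previous shape. -/
def idemAux (t : StandardTableau n lam) : ℕ → Hecke n
  | 0 => 1
  | k + 1 =>
    if h : k < n then
      idemAux t k *
        Polynomial.aeval (jm n (k + 1))
          (∏ b ∈ (addable (t.shape k)).erase (t.cell ⟨k, h⟩).1,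
            Polynomial.C (t.sigma ⟨k, h⟩ - qContent b)⁻¹ *
              (Polynomial.X - Polynomial.C (qContent b)))
    else idemAux t k

/-- The idempotent `E_t` of the Hecke algebra attached to a standard tableau `t`. -/
def idem (t : StandardTableau n lam) : Hecke n := t.idemAux n

end StandardTableau

/-- The `q`-number `[m]_q = (q^m - q^{-m}) / (q - q⁻¹)`. -/
def qNumber (m : ℤ) : Kq := (q ^ m - q ^ (-m)) / (q - q⁻¹)

/-- The hook length `λ_i + λ'_j - i - j + 1` of a cell (in coordinates counted from `0`). -/
def hook (lam : YoungDiagram) (c : ℕ × ℕ) : ℤ :=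
  (lam.rowLen c.1 : ℤ) + (lam.colLen c.2 : ℤ) - (c.1 : ℤ) - (c.2 : ℤ) - 1

/-- The normalization factor `f(λ)`. -/
def normFactor (lam : YoungDiagram) : Kq :=
  ∏ c ∈ lam.cells, q ^ content c / qNumber (hook lam c)

/-! ### Rational functions with values in the Hecke algebra -/

/-- Polynomials in `u_1, …, u_n` over `ℂ(q)`. -/
abbrev Poly (n : ℕ) : Type := MvPolynomial (Fin n) Kq

/-- Rational functions in `u_1, …, u_n` over `ℂ(q)`. -/
abbrev Rat (n : ℕ) : Type := FractionRing (Poly n)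

/-- Rational functions in `u_1, …, u_n` with values in the Hecke algebra `H_n`. -/
abbrev RatHecke (n : ℕ) : Type := Rat n ⊗[Kq] Hecke n

/-- The variable `u_k` as a rational function. -/
def u (n : ℕ) (k : Fin n) : Rat n := algebraMap (Poly n) (Rat n) (MvPolynomial.X k)

/-- A constant of the Hecke algebra as a rational function. -/
def const (n : ℕ) (h : Hecke n) : RatHecke n := (1 : Rat n) ⊗ₜ[Kq] h

/-- The rational function `T_i(x, y) = T_i + (q - q⁻¹) / (x⁻¹ y - 1)`. -/
def baxterT (n i : ℕ) (x y : Rat n) : RatHecke n :=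
  const n (T n i) +
    algebraMap (Rat n) (RatHecke n) (algebraMap Kq (Rat n) (q - q⁻¹) / (x⁻¹ * y - 1))

/-- The rational function `Ψ(u_1, …, u_n)`. In the block of the variable `u_{k+1}`, which is
`T_k(u_1, u_{k+1}) T_{k-1}(u_2, u_{k+1}) ⋯ T_1(u_k, u_{k+1})`, the variables are indexed
from `0`; the block with `k = 0` is an empty product. -/
def Psi (n : ℕ) : RatHecke n :=
  (List.ofFn fun k : Fin n =>
    (List.ofFn fun j : Fin k.1 =>
      baxterT n (k.1 - j.1) (u n (j.castLE k.2.le)) (u n k)).prod).prod *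
    const n ((Tlong n n)⁻¹ : (Hecke n)ˣ)

/-- Substitution of `u_k = s` in a polynomial. -/
def subst (n : ℕ) (k : Fin n) (s : Kq) : Poly n →ₐ[Kq] Poly n :=
  MvPolynomial.aeval (Function.update MvPolynomial.X k (MvPolynomial.C s))

/-- Substitution of `u_k = s` in a polynomial with coefficients in the Hecke algebra. -/
def substHecke (n : ℕ) (k : Fin n) (s : Kq) :
    Poly n ⊗[Kq] Hecke n →ₐ[Kq] Poly n ⊗[Kq] Hecke n :=
  Algebra.TensorProduct.map (subst n k s) (AlgHom.id Kq (Hecke n))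

/-- A polynomial with coefficients in the Hecke algebra, as a rational function. -/
def toRatHecke (n : ℕ) : Poly n ⊗[Kq] Hecke n →ₐ[Kq] RatHecke n :=
  Algebra.TensorProduct.map (IsScalarTower.toAlgHom Kq (Poly n) (Rat n))
    (AlgHom.id Kq (Hecke n))

/-- The rational function `F` is regular at `u_k = s` (as a function of `u_k`, the other
variables being generic), and the evaluation of `F` at `u_k = s` is `G`: one can write `F = A / b`
with `b` not vanishing identically at `u_k = s`, and `G = A|_{u_k = s} / b|_{u_k = s}`.
The value `G` is unique by `EvaluatesTo.unique`. -/
def EvaluatesTo (n : ℕ) (k : Fin n) (s : Kq) (F G : RatHecke n) : Prop :=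
  ∃ (A : Poly n ⊗[Kq] Hecke n) (b : Poly n), subst n k s b ≠ 0 ∧
    F = (algebraMap (Poly n) (Rat n) b)⁻¹ • toRatHecke n A ∧
    G = (algebraMap (Poly n) (Rat n) (subst n k s b))⁻¹ • toRatHecke n (substHecke n k s A)

theorem toRatHecke_injective (n : ℕ) : Function.Injective (toRatHecke n) := by
  have h : Function.Injective
      (IsScalarTower.toAlgHom Kq (Poly n) (Rat n)).toLinearMap :=
    IsFractionRing.injective (Poly n) (Rat n)
  exact Module.Flat.rTensor_preserves_injective_linearMap (M := Hecke n) _ h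

theorem toRatHecke_smul (n : ℕ) (b : Poly n) (A : Poly n ⊗[Kq] Hecke n) :
    toRatHecke n (b • A) = algebraMap (Poly n) (Rat n) b • toRatHecke n A := by
  induction A using TensorProduct.induction_on with
  | zero => simp
  | tmul x y => simp [toRatHecke, TensorProduct.smul_tmul', Algebra.smul_def]
  | add x y hx hy => simp only [smul_add, map_add, hx, hy]

theorem substHecke_smul (n : ℕ) (k : Fin n) (s : Kq) (b : Poly n)
    (A : Poly n ⊗[Kq] Hecke n) :
    substHecke n k s (b • A) = subst n k s b • substHecke n k s A := by
  induction A using TensorProduct.induction_on with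
  | zero => simp
  | tmul x y => simp [substHecke, TensorProduct.smul_tmul']
  | add x y hx hy => simp only [smul_add, map_add, hx, hy]

theorem EvaluatesTo.unique {n : ℕ} {k : Fin n} {s : Kq} {F G G' : RatHecke n}
    (h : EvaluatesTo n k s F G) (h' : EvaluatesTo n k s F G') : G = G' := by
  obtain ⟨A, b, hb, hF, rfl⟩ := h
  obtain ⟨A', b', hb', hF', rfl⟩ := h'
  have inj := IsFractionRing.injective (Poly n) (Rat n)
  have nz : ∀ p : Poly n, p ≠ 0 → algebraMap (Poly n) (Rat n) p ≠ 0 := fun p hp =>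
    (map_ne_zero_iff _ inj).2 hp
  have hb0 : b ≠ 0 := fun h0 => hb (by rw [h0, map_zero])
  have hb0' : b' ≠ 0 := fun h0 => hb' (by rw [h0, map_zero])
  have key : ∀ (p p' : Poly n) (C C' : Poly n ⊗[Kq] Hecke n), p ≠ 0 → p' ≠ 0 →
      ((algebraMap (Poly n) (Rat n) p)⁻¹ • toRatHecke n C =
        (algebraMap (Poly n) (Rat n) p')⁻¹ • toRatHecke n C' ↔ p' • C = p • C') := by
    intro p p' C C' hp hp'
    rw [← (toRatHecke_injective n).eq_iff, toRatHecke_smul, toRatHecke_smul,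
      inv_smul_eq_iff₀ (nz p hp), smul_comm, eq_inv_smul_iff₀ (nz p' hp')]
  rw [hF] at hF'
  have e := (key b b' A A' hb0 hb0').1 hF'
  refine (key _ _ _ _ hb hb').2 ?_
  rw [← substHecke_smul, ← substHecke_smul, e]

end HeckeFusion

end

/-!
The proof has two independent halves.

**The characteristic identity of the Jucys–Murphy elements.** If `v` is a joint eigenvector of
`y_1, …, y_k` whose eigenvalues are the contents of a standard tableau of shape `mu`, then
`y_{k+1}` acts on `v` semisimply, with eigenvalues among the contents of the cells addable to `mu`
(`addableSpectrum`). This needs no classification of representations. The relation `y_k T_k = T_k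
y_{k+1} - (q - q⁻¹) y_{k+1}` turns the identity for `y_k`, applied to `T_k v`, into a polynomial
identity for `y_{k+1}` whose roots are the old addable contents together with the contents `q² σ`
and `q⁻² σ` of the cells to the right of and below the cell last added. If one of these two cells
is not addable, the eigenvector in question is moved by intertwiners to a tableau in which the last
contents would be `q² σ, σ, q² σ` (or `q⁻² σ, σ, q⁻² σ`), and there the braid relation kills it
(`Wt.eq_zero_of_braid`). Consequently the elements `E_t` defined by Lagrange interpolation are
idempotents, `y_k E_t = σ_k E_t`, and the idempotent `E_U` of the first `k` entries of `t` is the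
sum of the idempotents of all standard tableaux extending it by one cell (`sum_branch`).

**Fusion.** The Yang–Baxter equation gives the exchange relation `P_k B_k(v) = Y_k(v) P_k D_k`,
where `P_k` is the fusion product of `u_1, …, u_k`, `B_k(v)` is the block of the next variable `v`,
`D_k = T_k ⋯ T_1`, and `Y_k(v) = T_k(u_k, v) ⋯ T_1(u_1, v) T_1⁻¹ ⋯ T_k⁻¹` (`blockProd_mul_block`).
The relation survives the evaluations, because values are unique. So after evaluating `u_1, …, u_k`
the product `Y_k(v) E_U` has its image in that of `E_U`, and an induction based on this
(`Resolvent.succ`) shows `Y_k(v) E_U = s(v) (v - y_{k+1})⁻¹ E_U` with `s(v) = (v - 1) ∏ (v - q² σ)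
(v - q⁻² σ) / (v - σ)²` over the contents of the shape of `U`. By the spectral decomposition of
`y_{k+1}` the right-hand side is `∑ s(v) / (v - σ_c) E_c` over the addable cells `c`. The content
product `s` has a simple zero at each addable content (`contentProd_eq`), so at `v = σ_{k+1}` only
the term of the next tableau survives; its coefficient is `f(mu) / f(nu)`, where `mu` and `nu` are
the shapes of `U` and of the next tableau, by a telescoping comparison with hook lengths
(`IsAdd.normFactor`).
-/

noncomputable section

namespace HeckeFusion

/-! ### Relations in the Hecke algebra -/

/-- The parameter `q - q⁻¹` of the quadratic relation. -/
def eta : Kq := q - q⁻¹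

theorem q_ne_zero : q ≠ 0 := RatFunc.X_ne_zero

theorem q_zpow_eq_one {m : ℤ} (h : q ^ m = 1) : m = 0 := by
  have key : ∀ k : ℕ, q ^ k = 1 → k = 0 := by
    intro k hk
    have h1 : algebraMap (Polynomial ℂ) (RatFunc ℂ) (Polynomial.X ^ k)
        = algebraMap (Polynomial ℂ) (RatFunc ℂ) 1 := by
      rw [map_pow, map_one, RatFunc.algebraMap_X]; exact hk
    have h2 := congrArg Polynomial.natDegree (RatFunc.algebraMap_injective ℂ h1)
    simpa using h2
  obtain ⟨k, rfl | rfl⟩ := m.eq_nat_or_neg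
  · rw [zpow_natCast] at h; rw [key k h]; rfl
  · rw [zpow_neg, zpow_natCast, inv_eq_one] at h; rw [key k h]; rfl

theorem q_zpow_injective : Function.Injective fun m : ℤ => q ^ m := by
  intro a b h
  have h' : q ^ (a - b) = 1 := by
    rw [zpow_sub₀ q_ne_zero]
    exact div_eq_one_iff_eq (zpow_ne_zero _ q_ne_zero) |>.2 h
  have := q_zpow_eq_one h'
  omega

theorem eta_ne_zero : eta ≠ 0 := by
  intro h
  have h1 : q ^ (1 : ℤ) = q ^ (-1 : ℤ) := by
    rw [zpow_one, zpow_neg_one]; exact sub_eq_zero.1 h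
  have := q_zpow_injective h1
  omega

theorem q_sq_ne_neg_one : q ^ 2 ≠ -1 := by
  intro h
  have h1 : q ^ (4 : ℤ) = 1 := by
    have : q ^ 4 = 1 := by linear_combination (q ^ 2 - 1) * h
    exact_mod_cast this
  have := q_zpow_eq_one h1
  omega

theorem qContent_ne_zero (c : ℕ × ℕ) : qContent c ≠ 0 := zpow_ne_zero _ q_ne_zero

theorem qContent_eq_iff {c d : ℕ × ℕ} : qContent c = qContent d ↔ content c = content d := by
  refine ⟨fun h => ?_, fun h => by rw [qContent, qContent, h]⟩
  have := q_zpow_injective h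
  omega

section Relations

variable {n : ℕ}

theorem T_quad {i : ℕ} (h1 : 1 ≤ i) (h2 : i < n) :
    (T n i : Hecke n) * T n i = 1 + eta • (T n i : Hecke n) := by
  simp only [T, h1, h2, and_self, dif_pos]
  exact gen_mul_gen n _

theorem T_inv {i : ℕ} (h1 : 1 ≤ i) (h2 : i < n) :
    (((T n i)⁻¹ : (Hecke n)ˣ) : Hecke n) = T n i - eta • 1 := by
  simp only [T, h1, h2, and_self, dif_pos]
  rfl

theorem T_eq_one {i : ℕ} (h : ¬ (1 ≤ i ∧ i < n)) : T n i = 1 := dif_neg h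

theorem T_braid {i : ℕ} (h1 : 1 ≤ i) (h2 : i + 1 < n) :
    (T n i : Hecke n) * T n (i + 1) * T n i = T n (i + 1) * T n i * T n (i + 1) := by
  have hi : 1 ≤ i ∧ i < n := ⟨h1, by omega⟩
  have hj : 1 ≤ i + 1 ∧ i + 1 < n := ⟨by omega, h2⟩
  simp only [T, dif_pos hi, dif_pos hj]
  have h := RingQuot.mkAlgHom_rel Kq (HeckeRel.braid (n := n) ⟨i, hi⟩ ⟨i + 1, hj⟩ rfl)
  simp only [map_mul] at h
  exact h

theorem T_comm {i j : ℕ} (h : i + 1 < j ∨ j + 1 < i) :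
    Commute (T n i : Hecke n) (T n j) := by
  by_cases hi : 1 ≤ i ∧ i < n
  · by_cases hj : 1 ≤ j ∧ j < n
    · simp only [T, dif_pos hi, dif_pos hj]
      have h := RingQuot.mkAlgHom_rel Kq (HeckeRel.comm (n := n) ⟨i, hi⟩ ⟨j, hj⟩ h)
      simp only [map_mul] at h
      exact h
    · rw [T_eq_one hj]; exact Commute.one_right _
  · rw [T_eq_one hi]; exact Commute.one_left _

theorem jm_succ {k : ℕ} (hk : 1 ≤ k) :
    jm n (k + 1) = T n k * jm n k * T n k := by
  obtain ⟨k, rfl⟩ : ∃ m, k = m + 1 := ⟨k - 1, by omega⟩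
  rfl

theorem commute_jm {z : Hecke n} {k : ℕ} (h : ∀ i, 1 ≤ i → i < k → Commute z (T n i)) :
    Commute z (jm n k) := by
  induction k with
  | zero => exact Commute.one_right _
  | succ k ih =>
    rcases Nat.eq_zero_or_pos k with rfl | hk
    · exact Commute.one_right _
    · rw [jm_succ hk]
      have h1 := ih fun i hi hik => h i hi (by omega)
      have h2 := h k hk (by omega)
      exact (h2.mul_right h1).mul_right h2

theorem T_commute_jm_of_gt {i k : ℕ} (h : k < i) : Commute (T n i : Hecke n) (jm n k) :=
  commute_jm fun _ _ hj => T_comm (Or.inr (by omega))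

theorem T_commute_jm_of_lt {i k : ℕ} (h : i + 1 < k) (hk : k ≤ n) :
    Commute (T n i : Hecke n) (jm n k) := by
  induction k with
  | zero => omega
  | succ k ih =>
    rcases Nat.eq_zero_or_pos i with rfl | hi
    · rw [T_eq_one (by omega)]; exact Commute.one_left _
    rw [jm_succ (by omega)]
    rcases (show i + 1 = k ∨ i + 1 < k by omega) with rfl | hik
    · rw [jm_succ hi]
      have hb := T_braid (n := n) hi (by omega)
      have hc : Commute (T n (i + 1) : Hecke n) (jm n i) := T_commute_jm_of_gt (by omega)
      generalize (T n i : Hecke n) = a at *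
      generalize (T n (i + 1) : Hecke n) = b at *
      generalize jm n i = y at *
      calc a * (b * (a * y * a) * b) = (a * b * a) * y * (a * b) := by noncomm_ring
        _ = b * a * (b * y) * (a * b) := by rw [hb]; noncomm_ring
        _ = b * a * y * (b * a * b) := by rw [hc.eq]; noncomm_ring
        _ = b * (a * y * a) * b * a := by rw [← hb]; noncomm_ring
    · have h1 : Commute (T n i : Hecke n) (T n k) := T_comm (Or.inl hik)
      exact (h1.mul_right (ih hik (by omega))).mul_right h1

theorem jm_commute {j k : ℕ} (hj : j ≤ n) (hk : k ≤ n) : Commute (jm n j) (jm n k) := by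
  have key : ∀ {j k : ℕ}, j < k → k ≤ n → Commute (jm n j) (jm n k) := fun {j k} hjk hk =>
    (commute_jm fun i _ hi => (T_commute_jm_of_lt (by omega) hk).symm).symm
  rcases lt_trichotomy j k with h | rfl | h
  · exact key h hk
  · exact Commute.refl _
  · exact (key h hj).symm

/-- `y_k T_k = T_k y_{k+1} - (q - q⁻¹) y_{k+1}`. -/
theorem jm_mul_T {k : ℕ} (h1 : 1 ≤ k) (h2 : k < n) :
    jm n k * T n k = T n k * jm n (k + 1) - eta • jm n (k + 1) := by
  have h := T_quad (n := n) h1 h2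
  rw [jm_succ h1]
  generalize (T n k : Hecke n) = a at *
  generalize jm n k = y at *
  calc y * a = (1 + eta • a) * (y * a) - eta • (a * (y * a)) := by
        rw [add_mul, one_mul, smul_mul_assoc, add_sub_cancel_right]
    _ = a * (a * y * a) - eta • (a * y * a) := by rw [← h]; simp only [mul_assoc]

/-- `y_{k+1} T_k = T_k y_k + (q - q⁻¹) y_{k+1}`. -/
theorem jm_succ_mul_T {k : ℕ} (h1 : 1 ≤ k) (h2 : k < n) :
    jm n (k + 1) * T n k = T n k * jm n k + eta • jm n (k + 1) := by
  have h := T_quad (n := n) h1 h2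
  rw [jm_succ h1]
  generalize (T n k : Hecke n) = a at *
  generalize jm n k = y at *
  calc a * y * a * a = a * y * (a * a) := by rw [mul_assoc]
    _ = a * y + eta • (a * y * a) := by rw [h, mul_add, mul_one, mul_smul_comm]

theorem commute_aeval {z y : Hecke n} (h : Commute z y) (r : Polynomial Kq) :
    Commute z (Polynomial.aeval y r) := by
  induction r using Polynomial.induction_on' with
  | add p r hp hr => rw [map_add]; exact hp.add_right hr
  | monomial k a =>
    rw [Polynomial.aeval_monomial]
    exact (Algebra.commute_algebraMap_right a z).mul_right (h.pow_right k)

theorem aeval_mul_of_eigen {y v : Hecke n} {s : Kq} (h : y * v = s • v) (r : Polynomial Kq) :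
    Polynomial.aeval y r * v = r.eval s • v := by
  induction r using Polynomial.induction_on' with
  | add p r hp hr => rw [map_add, add_mul, hp, hr, Polynomial.eval_add, add_smul]
  | monomial k a =>
    have hk : y ^ k * v = s ^ k • v := by
      induction k with
      | zero => simp
      | succ k ih => rw [pow_succ, mul_assoc, h, mul_smul_comm, ih, smul_smul, pow_succ, mul_comm]
    rw [Polynomial.aeval_monomial, Polynomial.eval_monomial, mul_assoc, hk, mul_smul_comm,
      ← Algebra.smul_def, smul_smul, mul_comm]

end Relations

/-! ### Addable and removable cells of Young diagrams -/

/-- The diagram `nu` is obtained from `mu` by adding the cell `c`. -/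
def IsAdd (mu : YoungDiagram) (c : ℕ × ℕ) (nu : YoungDiagram) : Prop :=
  c ∉ mu ∧ nu.cells = insert c mu.cells

theorem content_eq_of_le {c d : ℕ × ℕ} (h : content c = content d) : c ≤ d ∨ d ≤ c := by
  obtain ⟨a, b⟩ := c
  obtain ⟨a', b'⟩ := d
  simp only [content] at h
  simp only [Prod.mk_le_mk]
  omega

theorem mem_addable_iff {mu : YoungDiagram} {c : ℕ × ℕ} :
    c ∈ addable mu ↔ c ∉ mu ∧ ∀ d < c, d ∈ mu := by
  rw [mem_addable]
  refine and_congr Iff.rfl ⟨fun h d hd => ?_, fun h => ?_⟩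
  · rcases h hd.le (Set.mem_insert _ _) with h1 | h1
    · exact absurd h1 hd.ne
    · exact h1
  · intro e d hde he
    rcases he with rfl | he
    · rcases hde.eq_or_lt with rfl | hlt
      · exact Set.mem_insert _ _
      · exact Set.mem_insert_of_mem _ (h d hlt)
    · exact Set.mem_insert_of_mem _ (mu.isLowerSet hde he)

theorem addable_content_injOn (mu : YoungDiagram) :
    Set.InjOn content (addable mu : Set (ℕ × ℕ)) := by
  have key : ∀ c ∈ addable mu, ∀ d ∈ addable mu, c ≤ d → c = d := by
    intro c hc d hd hle
    by_contra hne
    exact (mem_addable_iff.1 hc).1 ((mem_addable_iff.1 hd).2 c (lt_of_le_of_ne hle hne))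
  intro c hc d hd h
  rcases content_eq_of_le h with h' | h'
  · exact key c hc d hd h'
  · exact (key d hd c hc h').symm

theorem addable_qContent_injOn (mu : YoungDiagram) :
    Set.InjOn qContent (addable mu : Set (ℕ × ℕ)) := fun _ hc _ hd h =>
  addable_content_injOn mu hc hd (qContent_eq_iff.1 h)

theorem addable_bot : addable ⊥ = {(0, 0)} := by
  ext c
  rw [mem_addable_iff, Finset.mem_singleton]
  refine ⟨fun h => ?_, ?_⟩
  · by_contra hne
    exact YoungDiagram.notMem_bot _ (h.2 (0, 0) (lt_of_le_of_ne ⟨Nat.zero_le _, Nat.zero_le _⟩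
      (Ne.symm hne)))
  · rintro rfl
    refine ⟨YoungDiagram.notMem_bot _, fun d hd => absurd hd ?_⟩
    exact not_lt_of_ge ⟨Nat.zero_le _, Nat.zero_le _⟩

theorem addable_nonempty (mu : YoungDiagram) : (addable mu).Nonempty := by
  refine ⟨(0, mu.rowLen 0), mem_addable_iff.2 ⟨?_, ?_⟩⟩
  · rw [YoungDiagram.mem_iff_lt_rowLen]; exact lt_irrefl _
  · rintro ⟨i, j⟩ hd
    rw [Prod.mk_lt_mk] at hd
    obtain rfl : i = 0 := by omega
    rw [YoungDiagram.mem_iff_lt_rowLen]; omega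

namespace IsAdd

variable {mu nu : YoungDiagram} {c : ℕ × ℕ}

theorem mem_iff (h : IsAdd mu c nu) {d : ℕ × ℕ} : d ∈ nu ↔ d = c ∨ d ∈ mu := by
  rw [← YoungDiagram.mem_cells, h.2, Finset.mem_insert, YoungDiagram.mem_cells]

theorem card (h : IsAdd mu c nu) : nu.card = mu.card + 1 := by
  rw [YoungDiagram.card, h.2, Finset.card_insert_of_notMem (by simpa using h.1)]

theorem mem_of_lt (h : IsAdd mu c nu) {d : ℕ × ℕ} (hd : d < c) : d ∈ mu := by
  have h1 : d ∈ nu := nu.isLowerSet hd.le (h.mem_iff.2 (Or.inl rfl))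
  exact (h.mem_iff.1 h1).resolve_left hd.ne

theorem mem_addable (h : IsAdd mu c nu) : c ∈ addable mu :=
  mem_addable_iff.2 ⟨h.1, fun _ hd => h.mem_of_lt hd⟩

theorem eq_of_le (h : IsAdd mu c nu) {d : ℕ × ℕ} (hd : d ∈ nu) (hcd : c ≤ d) : d = c := by
  by_contra hne
  exact h.1 (mu.isLowerSet hcd ((h.mem_iff.1 hd).resolve_left hne))

theorem addable_erase_subset (h : IsAdd mu c nu) : (addable mu).erase c ⊆ addable nu := by
  intro d hd
  obtain ⟨hne, hd⟩ := Finset.mem_erase.1 hd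
  rw [mem_addable_iff] at hd ⊢
  refine ⟨fun h1 => ?_, fun e he => h.mem_iff.2 (Or.inr (hd.2 e he))⟩
  exact hd.1 ((h.mem_iff.1 h1).resolve_left hne)

end IsAdd

theorem exists_isAdd_of_maximal {nu : YoungDiagram} {c : ℕ × ℕ} (hc : c ∈ nu)
    (hmax : ∀ d ∈ nu, c ≤ d → d = c) : ∃ mu, IsAdd mu c nu := by
  refine ⟨⟨nu.cells.erase c, ?_⟩, ?_, ?_⟩
  · intro d e hed hd
    simp only [Finset.coe_erase, Set.mem_sdiff, Finset.mem_coe, Set.mem_singleton_iff] at hd ⊢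
    refine ⟨nu.isLowerSet hed hd.1, ?_⟩
    rintro rfl
    exact hd.2 (hmax d hd.1 hed)
  · rw [← YoungDiagram.mem_cells]; simp
  · exact (Finset.insert_erase hc).symm

/-- Two distinct removable cells can be removed in either order, and their contents differ by
at least two. -/
theorem IsAdd.diamond {mu mu' nu : YoungDiagram} {c d : ℕ × ℕ} (hc : IsAdd mu c nu)
    (hd : IsAdd mu' d nu) (hne : d ≠ c) :
    (∃ ka, IsAdd ka d mu ∧ IsAdd ka c mu') ∧
      (content d + 2 ≤ content c ∨ content c + 2 ≤ content d) := by
  have hdm : d ∈ mu := (hc.mem_iff.1 (hd.mem_iff.2 (Or.inl rfl))).resolve_left hne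
  have hcm : c ∈ mu' := (hd.mem_iff.1 (hc.mem_iff.2 (Or.inl rfl))).resolve_left hne.symm
  constructor
  · obtain ⟨ka, hka⟩ := exists_isAdd_of_maximal hdm
      fun e he hde => hd.eq_of_le (hc.mem_iff.2 (Or.inr he)) hde
    refine ⟨ka, hka, fun h => hc.1 (hka.mem_iff.2 (Or.inr h)), ?_⟩
    ext e
    have h1 := hc.mem_iff (d := e)
    have h2 := hd.mem_iff (d := e)
    have h3 := hka.mem_iff (d := e)
    have h4 := hd.1
    have h5 := hka.1
    rw [Finset.mem_insert, YoungDiagram.mem_cells, YoungDiagram.mem_cells]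
    by_cases he : e = d
    · subst he; tauto
    · by_cases he' : e = c
      · subst he'; tauto
      · tauto
  · have h1 : ¬ c ≤ d := fun h => hne (hc.eq_of_le (hd.mem_iff.2 (Or.inl rfl)) h)
    have h2 : ¬ d ≤ c := fun h => hne.symm (hd.eq_of_le (hc.mem_iff.2 (Or.inl rfl)) h)
    obtain ⟨a, b⟩ := c
    obtain ⟨a', b'⟩ := d
    simp only [Prod.mk_le_mk] at h1 h2
    simp only [content]
    omega

/-- If the cell to the right of the added cell `c` is not addable, then the cell above `c` was
removable. -/
theorem IsAdd.exists_above {mu nu : YoungDiagram} {c : ℕ × ℕ} (h : IsAdd mu c nu)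
    (hr : (c.1, c.2 + 1) ∉ addable nu) :
    ∃ ka d, IsAdd ka d mu ∧ d < c ∧ content d = content c + 1 := by
  obtain ⟨i, j⟩ := c
  simp only at hr
  have hri : (i, j + 1) ∉ nu := fun h' => by
    have := h.eq_of_le h' ⟨le_rfl, Nat.le_succ j⟩
    simp at this
  rw [mem_addable_iff] at hr
  push Not at hr
  obtain ⟨⟨a, b⟩, hlt, hnot⟩ := hr hri
  rw [Prod.mk_lt_mk] at hlt
  have hcn : (i, j) ∈ nu := h.mem_iff.2 (Or.inl rfl)
  have hb : b = j + 1 := by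
    by_contra hb
    exact hnot (nu.up_left_mem (by omega) (by omega) hcn)
  subst hb
  obtain ⟨i, rfl⟩ : ∃ k, i = k + 1 := ⟨i - 1, by omega⟩
  have hnot' : (i, j + 1) ∉ nu := fun h' => hnot (nu.up_left_mem (by omega) le_rfl h')
  have hlt' : ((i, j) : ℕ × ℕ) < (i + 1, j) := by rw [Prod.mk_lt_mk]; omega
  obtain ⟨ka, hka⟩ := exists_isAdd_of_maximal (h.mem_of_lt hlt') (by
    rintro ⟨a', b'⟩ he hle
    rw [Prod.mk_le_mk] at hle
    have h1 : ¬ i + 1 ≤ a' := fun h' => h.1 (mu.up_left_mem h' hle.2 he)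
    have h2 : ¬ j + 1 ≤ b' := fun h' =>
      hnot' (h.mem_iff.2 (Or.inr (mu.up_left_mem hle.1 h' he)))
    rw [Prod.mk.injEq]; omega)
  exact ⟨ka, _, hka, hlt', by simp only [content]; push_cast; ring⟩

/-- If the cell below the added cell `c` is not addable, then the cell to the left of `c` was
removable. -/
theorem IsAdd.exists_left {mu nu : YoungDiagram} {c : ℕ × ℕ} (h : IsAdd mu c nu)
    (hr : (c.1 + 1, c.2) ∉ addable nu) :
    ∃ ka d, IsAdd ka d mu ∧ d < c ∧ content d = content c - 1 := by
  obtain ⟨i, j⟩ := c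
  simp only at hr
  have hri : (i + 1, j) ∉ nu := fun h' => by
    have := h.eq_of_le h' ⟨Nat.le_succ i, le_rfl⟩
    simp at this
  rw [mem_addable_iff] at hr
  push Not at hr
  obtain ⟨⟨a, b⟩, hlt, hnot⟩ := hr hri
  rw [Prod.mk_lt_mk] at hlt
  have hcn : (i, j) ∈ nu := h.mem_iff.2 (Or.inl rfl)
  have ha : a = i + 1 := by
    by_contra ha
    exact hnot (nu.up_left_mem (by omega) (by omega) hcn)
  subst ha
  obtain ⟨j, rfl⟩ : ∃ k, j = k + 1 := ⟨j - 1, by omega⟩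
  have hnot' : (i + 1, j) ∉ nu := fun h' => hnot (nu.up_left_mem le_rfl (by omega) h')
  have hlt' : ((i, j) : ℕ × ℕ) < (i, j + 1) := by rw [Prod.mk_lt_mk]; omega
  obtain ⟨ka, hka⟩ := exists_isAdd_of_maximal (h.mem_of_lt hlt') (by
    rintro ⟨a', b'⟩ he hle
    rw [Prod.mk_le_mk] at hle
    have h1 : ¬ j + 1 ≤ b' := fun h' => h.1 (mu.up_left_mem hle.1 h' he)
    have h2 : ¬ i + 1 ≤ a' := fun h' =>
      hnot' (h.mem_iff.2 (Or.inr (mu.up_left_mem h' hle.2 he)))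
    rw [Prod.mk.injEq]; omega)
  exact ⟨ka, _, hka, hlt', by simp only [content]; push_cast; ring⟩

/-- If `d` and then `c > d` are added to a diagram, then no cell addable to that diagram has the
content of `c`, unless `c` and `d` are on the same diagonal. -/
theorem IsAdd.content_ne {ka mu nu : YoungDiagram} {c d : ℕ × ℕ} (hd : IsAdd ka d mu)
    (hc : IsAdd mu c nu) (hdc : d < c) (hcd : content d ≠ content c) {e : ℕ × ℕ}
    (he : e ∈ addable ka) : content e ≠ content c := by
  intro h
  rw [mem_addable_iff] at he
  rcases content_eq_of_le h with h1 | h1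
  · rcases h1.eq_or_lt with rfl | h1
    · exact hd.1 (he.2 d hdc)
    · rcases hd.mem_iff.1 (hc.mem_of_lt h1) with rfl | h2
      · exact hcd h
      · exact he.1 h2
  · rcases h1.eq_or_lt with rfl | h1
    · exact hd.1 (he.2 d hdc)
    · exact hc.1 (hd.mem_iff.2 (Or.inr (he.2 c h1)))

/-! ### Weight vectors for the Jucys–Murphy elements -/

section WeightVectors

open Polynomial (aeval)
open Lagrange (nodal)

-- For the tactic `module` to use the standard actions of `ℕ` and `ℤ` on `ℂ(q)` rather than those
-- found through the polynomial ring.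
local instance natAlgebraKq : Algebra ℕ Kq := Semiring.toNatAlgebra
local instance intAlgebraKq : Algebra ℤ Kq := Ring.toIntAlgebra _


/-- `Wt n mu v` says that `v` is a joint eigenvector of `y_1, …, y_{|mu|}` under left
multiplication, the eigenvalues being the `q`-contents of the cells of `mu` in the order in which
some standard tableau of shape `mu` fills them. The vector `v` may be zero. -/
inductive Wt (n : ℕ) : YoungDiagram → Hecke n → Prop
  | bot (v : Hecke n) : Wt n ⊥ v
  | add {mu nu : YoungDiagram} {c : ℕ × ℕ} {v : Hecke n} (h : Wt n mu v) (hc : IsAdd mu c nu)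
      (hv : jm n nu.card * v = qContent c • v) : Wt n nu v

variable {n : ℕ}

theorem inv_neg_inv {K : Type*} [Field K] (s : K) : (-s⁻¹)⁻¹ = -s := by
  rw [inv_neg, inv_inv]

theorem mul_eigen {z y v : Hecke n} {s : Kq} (h : Commute z y) (hv : y * v = s • v) :
    y * (z * v) = s • (z * v) := by
  rw [← mul_assoc, ← h.eq, mul_assoc, hv, mul_smul_comm]

theorem Wt.mul_left {mu : YoungDiagram} {v z : Hecke n} (h : Wt n mu v)
    (hz : ∀ j ≤ mu.card, Commute z (jm n j)) : Wt n mu (z * v) := by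
  induction h with
  | bot v => exact Wt.bot _
  | add h hc hv ih =>
    refine Wt.add (ih fun j hj => hz j (by rw [hc.card]; omega)) hc ?_
    exact mul_eigen (hz _ le_rfl) hv

/-- The intertwiner `T_k + (q - q⁻¹) b / (a - b)` exchanges the eigenvalues `a` and `b` of `y_k`
and `y_{k+1}`. -/
theorem intertwiner {k : ℕ} (h1 : 1 ≤ k) (h2 : k < n) {w : Hecke n} {a b t : Kq}
    (ha : jm n k * w = a • w) (hb : jm n (k + 1) * w = b • w) (ht : t * (a - b) = eta * b) :
    jm n k * ((T n k + t • 1) * w) = b • ((T n k + t • 1) * w) ∧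
      jm n (k + 1) * ((T n k + t • 1) * w) = a • ((T n k + t • 1) * w) := by
  have e1 : jm n k * (T n k * w) = b • ((T n k : Hecke n) * w) - (eta * b) • w := by
    rw [← mul_assoc, jm_mul_T h1 h2, sub_mul, mul_assoc, hb, smul_mul_assoc, hb, mul_smul_comm,
      smul_smul]
  have e2 : jm n (k + 1) * (T n k * w) = a • ((T n k : Hecke n) * w) + (eta * b) • w := by
    rw [← mul_assoc, jm_succ_mul_T h1 h2, add_mul, mul_assoc, ha, smul_mul_assoc, hb,
      mul_smul_comm, smul_smul]
  have e : ((T n k : Hecke n) + t • 1) * w = T n k * w + t • w := by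
    rw [add_mul, smul_mul_assoc, one_mul]
  rw [e, mul_add, mul_add, e1, e2, mul_smul_comm, mul_smul_comm, ha, hb]
  constructor
  · linear_combination (norm := module) ht • w
  · linear_combination (norm := module) (-ht) • w

theorem intertwiner_injective {k : ℕ} (h1 : 1 ≤ k) (h2 : k < n) {w : Hecke n} {t : Kq}
    (ht : 1 - t * eta - t ^ 2 ≠ 0) (h : ((T n k : Hecke n) + t • 1) * w = 0) : w = 0 := by
  have hq := T_quad (n := n) h1 h2
  have e : ((T n k : Hecke n) * T n k) * w = w + eta • (T n k * w) := by
    rw [hq, add_mul, one_mul, smul_mul_assoc]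
  have e1 : (T n k : Hecke n) * w = - (t • w) := by
    rw [add_mul, smul_mul_assoc, one_mul] at h
    exact eq_neg_of_add_eq_zero_left h
  rw [mul_assoc, e1, mul_neg, mul_smul_comm, e1] at e
  have : (1 - t * eta - t ^ 2) • w = 0 := by
    linear_combination (norm := module) -e
  exact (smul_eq_zero.1 this).resolve_left ht

/-- A weight vector for a standard tableau of shape `nu` can be transformed, by intertwiners, into
one for a standard tableau with its last entry in any given removable cell `d`. -/
theorem Wt.exists_move {nu : YoungDiagram} {v : Hecke n} (h : Wt n nu v) (hn : nu.card ≤ n)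
    {mu' : YoungDiagram} {d : ℕ × ℕ} (hd : IsAdd mu' d nu) :
    ∃ x : Hecke n, (∀ z : Hecke n, (∀ i, 1 ≤ i → i < nu.card → Commute z (T n i)) → Commute z x) ∧
      (x * v = 0 → v = 0) ∧ Wt n mu' (x * v) ∧ jm n nu.card * (x * v) = qContent d • (x * v) := by
  induction h generalizing mu' d with
  | bot v => exact absurd (hd.mem_iff.2 (Or.inl rfl)) (YoungDiagram.notMem_bot d)
  | @add mu nu c v h hc hv ih =>
    by_cases hdc : d = c
    · subst hdc
      have hmu : mu' = mu := by
        ext e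
        have h1 := hd.mem_iff (d := e)
        have h2 := hc.mem_iff (d := e)
        have h3 := hd.1
        have h4 := hc.1
        rw [YoungDiagram.mem_cells, YoungDiagram.mem_cells]
        by_cases he : e = d
        · subst he; tauto
        · tauto
      subst hmu
      exact ⟨1, fun z _ => Commute.one_right z, by simp, by simpa using h, by simpa using hv⟩
    · obtain ⟨⟨ka, hka, hka'⟩, hcon⟩ := hc.diamond hd hdc
      have hcard := hc.card
      have hcard' := hka.card
      have hcard'' := hka'.card
      obtain ⟨x, hx1, hx2, hx3, hx4⟩ := ih (by omega) hka
      have hk1 : 1 ≤ mu.card := by omega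
      have hk2 : mu.card < n := by omega
      rw [hcard] at hv
      have hv' : jm n (mu.card + 1) * (x * v) = qContent c • (x * v) :=
        mul_eigen (hx1 _ fun i _ hi =>
          (T_commute_jm_of_lt (by omega) (by omega)).symm).symm hv
      have hq : ∀ e : ℤ, content d ≠ content c + e → qContent d ≠ q ^ (2 * e) * qContent c := by
        intro e he h'
        rw [qContent, qContent, ← zpow_add₀ q_ne_zero] at h'
        have := q_zpow_injective h'
        omega
      have h0 := hq 0 (by omega)
      have hp := hq 1 (by omega)
      have hm := hq (-1) (by omega)
      rw [mul_zero, zpow_zero, one_mul] at h0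
      have h0' : qContent d - qContent c ≠ 0 := sub_ne_zero.2 h0
      obtain ⟨i1, i2⟩ := intertwiner (t := eta * qContent c / (qContent d - qContent c))
        hk1 hk2 hx4 hv' (div_mul_cancel₀ _ h0')
      refine ⟨(T n mu.card + (eta * qContent c / (qContent d - qContent c)) • 1) * x,
        fun z hz => ?_, fun h0 => ?_, ?_, ?_⟩
      · refine Commute.mul_right ?_ (hx1 z fun i hi hi' => hz i hi (by omega))
        exact (hz _ hk1 (by omega)).add_right ((Commute.one_right z).smul_right _)
      · refine hx2 (intertwiner_injective hk1 hk2 (fun hz => ?_) (by rwa [mul_assoc] at h0))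
        have key : (qContent d - q ^ (2 * 1 : ℤ) * qContent c) *
            (qContent d - q ^ (2 * (-1) : ℤ) * qContent c) = 0 := by
          have e2 : q ^ (2 * 1 : ℤ) = q * q := by rw [mul_one, zpow_two]
          have e3 : q ^ (2 * (-1) : ℤ) = q⁻¹ * q⁻¹ := by
            rw [mul_neg, mul_one, zpow_neg, zpow_two, mul_inv]
          have hqq : q * q⁻¹ = 1 := mul_inv_cancel₀ q_ne_zero
          rw [e2, e3]
          field_simp at hz
          rw [eta] at hz
          linear_combination hz + (qContent c ^ 2 * (q * q⁻¹ + 1) -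
            2 * qContent c * qContent d) * hqq
        rcases mul_eq_zero.1 key with h' | h'
        · exact hp (sub_eq_zero.1 h')
        · exact hm (sub_eq_zero.1 h')
      · refine Wt.add ?_ hka' ?_
        · rw [mul_assoc]
          refine hx3.mul_left fun j hj => ?_
          exact (T_commute_jm_of_gt (by omega)).add_left
            ((Commute.one_left _).smul_left _)
        · rw [mul_assoc, hcard'', ← hcard']; exact i1
      · rw [mul_assoc, hcard]; exact i2

/-! ### The characteristic identity for `y_{k+1}` -/

/-- `y_{|mu|+1}` acts on every weight vector of shape `mu` with eigenvalues among the
`q`-contents of the cells addable to `mu`, and semisimply. -/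
def AddableSpectrum (n : ℕ) (mu : YoungDiagram) : Prop :=
  ∀ v : Hecke n, Wt n mu v → aeval (jm n (mu.card + 1)) (nodal (addable mu) qContent) * v = 0

/-- The relation `y_k T_k = T_k y_{k+1} - (q - q⁻¹) y_{k+1}` for polynomials in `y_k`, on vectors of
the form `(y_{k+1} - s) v` with `y_k v = s v`; the divided difference of `r` then cancels. -/
theorem aeval_mul_T {k : ℕ} (h1 : 1 ≤ k) (h2 : k < n) {v : Hecke n} {s : Kq}
    (hv : jm n k * v = s • v) (r : Polynomial Kq) :
    aeval (jm n k) r * (T n k * ((jm n (k + 1) - s • 1) * v)) =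
      T n k * (aeval (jm n (k + 1)) r * ((jm n (k + 1) - s • 1) * v)) -
        eta • (jm n (k + 1) * ((aeval (jm n (k + 1)) r - r.eval s • 1) * v)) := by
  have hyT := jm_mul_T (n := n) h1 h2
  have hyY : Commute (jm n k) (jm n (k + 1)) := jm_commute (by omega) (by omega)
  generalize jm n k = y at *
  generalize jm n (k + 1) = Y at *
  generalize (T n k : Hecke n) = a at *
  induction r using Polynomial.induction_on with
  | C b =>
    simp only [Polynomial.aeval_C, Polynomial.eval_C, Algebra.algebraMap_eq_smul_one,
      smul_mul_assoc, one_mul, mul_smul_comm, sub_self, zero_mul, mul_zero, smul_zero, sub_zero]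
  | add p r hp hr =>
    simp only [map_add, add_mul, mul_add, Polynomial.eval_add, add_smul, sub_mul, mul_sub,
      smul_sub, smul_add] at hp hr ⊢
    linear_combination (norm := module) hp + hr
  | monomial m b ih =>
    have e : Polynomial.C b * Polynomial.X ^ (m + 1) =
        Polynomial.X * (Polynomial.C b * Polynomial.X ^ m) := by ring
    rw [e]
    generalize Polynomial.C b * Polynomial.X ^ m = r at *
    rw [map_mul, map_mul, Polynomial.aeval_X, Polynomial.aeval_X, mul_assoc, ih,
      Polynomial.eval_mul, Polynomial.eval_X]
    have c1 : Commute y (aeval Y r) := commute_aeval hyY r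
    have c2 : Commute Y (aeval Y r) := commute_aeval (Commute.refl Y) r
    generalize aeval Y r = R at *
    have e1 : ∀ w : Hecke n, y * (a * w) = a * (Y * w) - eta • (Y * w) := fun w => by
      rw [← mul_assoc, hyT, sub_mul, mul_assoc, smul_mul_assoc]
    have e2 : y * (Y * (R * v)) = s • (Y * (R * v)) := by
      rw [← mul_assoc Y, ← mul_assoc, (hyY.mul_right c1).eq, mul_assoc, hv, mul_smul_comm]
    have e3 : y * (Y * v) = s • (Y * v) := by
      rw [← mul_assoc, hyY.eq, mul_assoc, hv, mul_smul_comm]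
    have e4 : R * (Y * v) = Y * (R * v) := by rw [← mul_assoc, ← c2.eq, mul_assoc]
    simp only [sub_mul, mul_sub, smul_mul_assoc, one_mul, mul_smul_comm, smul_sub, e1, e2, e3, e4,
      mul_assoc]
    module

/-- Applying the characteristic identity of `y_k` to `T_k v` determines the action of `T_k` on
`(y_{k+1} - σ) r(y_{k+1}) v`, where `r` has the contents of the other addable cells as roots. -/
theorem AddableSpectrum.T_mul {mu nu : YoungDiagram} {c : ℕ × ℕ} (hA : AddableSpectrum n mu)
    (hc : IsAdd mu c nu) (hn : nu.card < n) {v : Hecke n} (hw : Wt n mu v)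
    (hv : jm n nu.card * v = qContent c • v) :
    T n nu.card * ((jm n (nu.card + 1) - qContent c • 1) *
        (aeval (jm n (nu.card + 1)) (nodal ((addable mu).erase c) qContent) * v)) =
      eta • (jm n (nu.card + 1) *
        (aeval (jm n (nu.card + 1)) (nodal ((addable mu).erase c) qContent) * v)) := by
  have hcard := hc.card
  have h1 : 1 ≤ nu.card := by omega
  have h0 := hA _ (hw.mul_left (z := T n nu.card)
    fun j hj => T_commute_jm_of_gt (by omega))
  rw [← hcard, Lagrange.nodal_eq_mul_nodal_erase hc.mem_addable, mul_comm, map_mul, map_sub,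
    Polynomial.aeval_X, Polynomial.aeval_C, mul_assoc, Algebra.algebraMap_eq_smul_one] at h0
  have h2 := aeval_mul_T h1 hn hv (nodal ((addable mu).erase c) qContent)
  have hyT := jm_mul_T (n := n) h1 hn
  have hyY : Commute (jm n nu.card) (jm n (nu.card + 1)) := jm_commute (by omega) (by omega)
  have hr := aeval_mul_of_eigen hv (nodal ((addable mu).erase c) qContent)
  have c1 := commute_aeval hyY.symm (nodal ((addable mu).erase c) qContent)
  have c2 := commute_aeval (Commute.refl (jm n (nu.card + 1)))
    (nodal ((addable mu).erase c) qContent)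
  generalize nodal ((addable mu).erase c) qContent = r at *
  generalize qContent c = s at *
  generalize jm n nu.card = y at *
  generalize jm n (nu.card + 1) = Y at *
  generalize (T n nu.card : Hecke n) = a at *
  generalize aeval y r = R' at *
  generalize aeval Y r = R at *
  have e1 : (y - s • 1) * (a * v) = a * ((Y - s • 1) * v) - eta • (Y * v) := by
    rw [sub_mul, ← mul_assoc, hyT]
    simp only [sub_mul, mul_sub, smul_mul_assoc, one_mul, mul_smul_comm, mul_assoc]
    abel
  have e2 : R' * (Y * v) = r.eval s • (Y * v) := by
    rw [← mul_assoc, ← c1.eq, mul_assoc, hr, mul_smul_comm]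
  have e4 : R * (Y * v) = Y * (R * v) := by rw [← mul_assoc, ← c2.eq, mul_assoc]
  rw [e1, mul_sub, h2, mul_smul_comm, e2] at h0
  simp only [sub_mul, mul_sub, smul_mul_assoc, one_mul, mul_smul_comm, smul_sub, e4] at h0 ⊢
  linear_combination (norm := module) h0

/-- If `y_{k+1}` has the eigenvalue `s² t` on `v`, with `s = q` or `s = -q⁻¹`, and a relation as in
`AddableSpectrum.T_mul` holds, then `T_k` acts on `v` by `s`. -/
theorem T_mul_of_eigen {k : ℕ} {v : Hecke n} {s t : Kq} (hs : s - s⁻¹ = eta) (ht : t ≠ 0)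
    (h : T n k * ((jm n (k + 1) - t • 1) * v) = eta • (jm n (k + 1) * v))
    (hv : jm n (k + 1) * v = (s ^ 2 * t) • v) : T n k * v = s • v := by
  have hs0 : s ≠ 0 := by
    rintro rfl
    exact eta_ne_zero (by rw [← hs]; simp)
  rw [sub_mul, smul_mul_assoc, one_mul, hv, ← sub_smul, mul_smul_comm, smul_smul] at h
  have e1 : s ^ 2 * t - t = eta * (s * t) := by
    rw [← hs]; field_simp
  have e2 : eta * (s ^ 2 * t) = (eta * (s * t)) * s := by ring
  rw [e1, e2, mul_smul (eta * (s * t))] at h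
  exact smul_right_injective _ (mul_ne_zero eta_ne_zero (mul_ne_zero hs0 ht)) h

/-- A weight vector whose weight would continue a standard tableau by contents
`…, s² σ, σ, s² σ` vanishes by the braid relation. -/
theorem Wt.eq_zero_of_braid {ka mu nu : YoungDiagram} {c d : ℕ × ℕ} {v : Hecke n} {s : Kq}
    (hA : AddableSpectrum n ka) (hd : IsAdd ka d mu) (hc : IsAdd mu c nu) (hdc : d < c)
    (hs : s - s⁻¹ = eta) (hs2 : s ^ 2 ≠ -1) (hcd : qContent d = s ^ 2 * qContent c)
    (hcon : content d ≠ content c) (hn : nu.card < n) (hw : Wt n mu v)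
    (hv : jm n nu.card * v = qContent c • v) (hT : T n nu.card * v = s • v) : v = 0 := by
  have hcard := hc.card
  have hcard' := hd.card
  have hs0 : s ≠ 0 := by
    rintro rfl
    exact eta_ne_zero (by rw [← hs]; simp)
  obtain ⟨x, hx1, hx2, hx3, hx4⟩ := hw.exists_move (by omega) hd
  refine hx2 ?_
  have hxT : Commute (T n nu.card : Hecke n) x := hx1 _ fun i _ hi => T_comm (by omega)
  have hw1 : T n nu.card * (x * v) = s • (x * v) := by
    rw [← mul_assoc, hxT.eq, mul_assoc, hT, mul_smul_comm]
  have hw2 : jm n nu.card * (x * v) = qContent c • (x * v) :=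
    mul_eigen (hx1 _ fun i _ hi => (T_commute_jm_of_lt (by omega) (by omega)).symm).symm hv
  have hw3 : T n mu.card * (x * v) = (-s⁻¹) • (x * v) := by
    have h3 := hA.T_mul hd (by omega) hx3 hx4
    rw [hcard] at hw2
    have hw2' : jm n (mu.card + 1) * (x * v) = ((-s⁻¹) ^ 2 * qContent d) • (x * v) := by
      rw [hw2, hcd]; congr 1; field_simp
    refine T_mul_of_eigen (t := qContent d) (by rw [← hs, inv_neg_inv]; ring)
      (qContent_ne_zero d) ?_ hw2'
    rw [aeval_mul_of_eigen hw2] at h3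
    have hne : (nodal ((addable ka).erase d) qContent).eval (qContent c) ≠ 0 := by
      rw [Lagrange.eval_nodal, Finset.prod_ne_zero_iff]
      intro e he
      rw [sub_ne_zero, Ne, qContent_eq_iff]
      exact (hd.content_ne hc hdc hcon (Finset.mem_of_mem_erase he)).symm
    simp only [mul_smul_comm] at h3
    rw [smul_comm eta] at h3
    exact smul_right_injective _ hne h3
  have hb := congrArg (· * (x * v)) (T_braid (n := n) (i := mu.card) (by omega) (by omega))
  rw [hcard] at hw1
  simp only [mul_assoc, hw1, hw3, mul_smul_comm, smul_smul] at hb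
  have : (s * (s ^ 2 + 1)) • (x * v) = 0 := by
    have e1 : -s⁻¹ * (s * -s⁻¹) = s⁻¹ := by field_simp
    have e2 : s * (-s⁻¹ * s) = -s := by field_simp
    have e3 : s * (s ^ 2 + 1) = s ^ 2 * (s⁻¹ + s) := by field_simp; ring
    rw [e1, e2] at hb
    rw [e3, mul_smul, add_smul, hb, neg_smul, neg_add_cancel, smul_zero]
  refine (smul_eq_zero.1 this).resolve_left (mul_ne_zero hs0 fun h => hs2 ?_)
  linear_combination h

/-- In the situation of `AddableSpectrum.T_mul`, the relation `y_{k+1} = T_k y_k T_k` leaves only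
the two eigenvalues `q² t` and `q⁻² t` for `y_{k+1}`. -/
theorem quadratic_of_T_mul {k : ℕ} (h1 : 1 ≤ k) (h2 : k < n) {v : Hecke n} {t : Kq}
    (hv : jm n k * v = t • v)
    (h : T n k * ((jm n (k + 1) - t • 1) * v) = eta • (jm n (k + 1) * v)) :
    jm n (k + 1) * (jm n (k + 1) * v) =
      ((q ^ 2 + q⁻¹ ^ 2) * t) • (jm n (k + 1) * v) - (t ^ 2) • v := by
  have hq := T_quad (n := n) h1 h2
  have hyT := jm_mul_T (n := n) h1 h2
  have hyY : Commute (jm n k) (jm n (k + 1)) := jm_commute (by omega) (by omega)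
  generalize jm n k = y at *
  generalize jm n (k + 1) = Y at *
  generalize (T n k : Hecke n) = a at *
  have haa : ∀ w : Hecke n, a * (a * w) = w + eta • (a * w) := fun w => by
    rw [← mul_assoc, hq, add_mul, one_mul, smul_mul_assoc]
  have e1 : y * (a * ((Y - t • 1) * v)) =
      a * (Y * ((Y - t • 1) * v)) - eta • (Y * ((Y - t • 1) * v)) := by
    rw [← mul_assoc, hyT, sub_mul, mul_assoc, smul_mul_assoc]
  have e2 : y * (Y * v) = t • (Y * v) := by
    rw [← mul_assoc, hyY.eq, mul_assoc, hv, mul_smul_comm]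
  have e3 := congrArg (a * ·) e1
  rw [h, mul_sub, haa, mul_smul_comm, mul_smul_comm, mul_smul_comm, e2, add_sub_cancel_right,
    mul_smul_comm] at e3
  have e4 := haa ((Y - t • 1) * v)
  rw [h, mul_smul_comm] at e4
  have hqq : q * q⁻¹ = 1 := mul_inv_cancel₀ q_ne_zero
  have e5 : eta * eta = q ^ 2 + q⁻¹ ^ 2 - 2 := by
    rw [eta]; linear_combination (-2) * hqq
  have e6 : (q ^ 2 + q⁻¹ ^ 2) = eta * eta + 2 := by rw [e5]; ring
  rw [e6]
  simp only [sub_mul, mul_sub, smul_mul_assoc, one_mul, mul_smul_comm] at e3 e4 ⊢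
  linear_combination (norm := module) -e3 + t • e4

/-- The characteristic identity for `y_{|mu|+1}` on weight vectors of shape `mu`. -/
theorem addableSpectrum (mu : YoungDiagram) (hn : mu.card < n) : AddableSpectrum n mu := by
  induction hm : mu.card using Nat.strong_induction_on generalizing mu with
  | _ m ih =>
  subst hm
  intro v hw
  cases hw with
  | bot v =>
    have h1 : jm n ((⊥ : YoungDiagram).card + 1) = 1 := rfl
    rw [addable_bot, nodal, Finset.prod_singleton, h1, map_sub, Polynomial.aeval_X,
      Polynomial.aeval_C, qContent, content]
    simp
  | @add mu0 _ c _ hw hc hv =>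
    rename' mu => nu, mu0 => mu
    have hcard := hc.card
    have hA : AddableSpectrum n mu := ih mu.card (by omega) mu (by omega) rfl
    have h1 : 1 ≤ nu.card := by omega
    have hyY : Commute (jm n nu.card) (jm n (nu.card + 1)) := jm_commute (by omega) (by omega)
    set Y := jm n (nu.card + 1) with hY
    set r := nodal ((addable mu).erase c) qContent with hr
    have hYj : ∀ (p : Polynomial Kq), ∀ j ≤ mu.card, Commute (aeval Y p) (jm n j) := fun p j hj =>
      (commute_aeval (jm_commute (by omega) (by omega)) p).symm
    have hYy : ∀ p : Polynomial Kq, Commute (aeval Y p) (jm n nu.card) := fun p =>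
      (commute_aeval hyY p).symm
    have hquad : Y * (Y * (aeval Y r * v)) =
        ((q ^ 2 + q⁻¹ ^ 2) * qContent c) • (Y * (aeval Y r * v)) -
          (qContent c ^ 2) • (aeval Y r * v) :=
      quadratic_of_T_mul h1 hn (mul_eigen (hYy r) hv) (hA.T_mul hc hn hw hv)
    -- With `s = q` or `s = -q⁻¹`: if `mu` has a removable cell of content `s² σ`, then the
    -- eigenvalue `s² σ` of `y_{k+1}` does not occur, and only `s⁻² σ` is left.
    have key : ∀ s : Kq, s - s⁻¹ = eta → s ^ 2 ≠ -1 → q ^ 2 + q⁻¹ ^ 2 = s ^ 2 + s⁻¹ ^ 2 →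
        ∀ ka d, IsAdd ka d mu → d < c → content d ≠ content c →
        qContent d = s ^ 2 * qContent c →
        (Y - (s⁻¹ ^ 2 * qContent c) • 1) * (aeval Y r * v) = 0 := by
      intro s hs hs2 hsq ka d hd hdc hcon hcd
      have hs0 : s ≠ 0 := by
        rintro rfl
        exact eta_ne_zero (by rw [← hs]; simp)
      have hcard' := hd.card
      have hpoly : Y - (s⁻¹ ^ 2 * qContent c) • 1 =
          aeval Y (Polynomial.X - Polynomial.C (s⁻¹ ^ 2 * qContent c)) := by
        rw [map_sub, Polynomial.aeval_X, Polynomial.aeval_C, Algebra.algebraMap_eq_smul_one]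
      have hcomm : Commute (aeval Y (Polynomial.X - Polynomial.C (s⁻¹ ^ 2 * qContent c)))
          (aeval Y r) := by
        rw [Commute, SemiconjBy, ← map_mul, ← map_mul, mul_comm]
      have hsw : aeval Y (Polynomial.X - Polynomial.C (s⁻¹ ^ 2 * qContent c)) * (aeval Y r * v) =
          aeval Y r * (aeval Y (Polynomial.X - Polynomial.C (s⁻¹ ^ 2 * qContent c)) * v) := by
        rw [← mul_assoc, hcomm.eq, mul_assoc]
      have hw' := hw.mul_left (hYj (Polynomial.X - Polynomial.C (s⁻¹ ^ 2 * qContent c)))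
      have hv' := mul_eigen (hYy (Polynomial.X - Polynomial.C (s⁻¹ ^ 2 * qContent c))) hv
      have hT := hA.T_mul hc hn hw' hv'
      rw [← hY, ← hr, ← hsw] at hT
      have hv1 : Y * (aeval Y (Polynomial.X - Polynomial.C (s⁻¹ ^ 2 * qContent c)) *
          (aeval Y r * v)) = (s ^ 2 * qContent c) •
            (aeval Y (Polynomial.X - Polynomial.C (s⁻¹ ^ 2 * qContent c)) *
              (aeval Y r * v)) := by
        rw [← hpoly]
        have hss : s ^ 2 * s⁻¹ ^ 2 = 1 := by field_simp
        simp only [sub_mul, mul_sub, smul_mul_assoc, one_mul, mul_smul_comm, smul_sub, hquad,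
          hsq]
        rw [smul_smul (s ^ 2 * qContent c), show s ^ 2 * qContent c * (s⁻¹ ^ 2 * qContent c) =
          s ^ 2 * s⁻¹ ^ 2 * qContent c ^ 2 by ring, hss, one_mul]
        module
      rw [hpoly]
      have hA' : AddableSpectrum n ka := ih ka.card (by omega) ka (by omega) rfl
      refine Wt.eq_zero_of_braid hA' hd hc hdc hs hs2 hcd hcon hn
        ((hw.mul_left (hYj r)).mul_left (hYj _))
        (mul_eigen (hYy _) (mul_eigen (hYy r) hv)) ?_
      exact T_mul_of_eigen hs (qContent_ne_zero c) hT hv1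
    have hq2 : (q ^ 2 : Kq) ≠ -1 := q_sq_ne_neg_one
    have hq2' : ((-q⁻¹) ^ 2 : Kq) ≠ -1 := by
      intro h
      apply hq2
      have hqq : q * q⁻¹ = 1 := mul_inv_cancel₀ q_ne_zero
      linear_combination (q ^ 2) * h - (q * q⁻¹ + 1) * hqq
    have hcr : qContent (c.1, c.2 + 1) = q ^ 2 * qContent c := by
      rw [qContent, qContent, ← zpow_natCast, ← zpow_add₀ q_ne_zero]
      congr 1; simp only [content]; push_cast; ring
    have hcb : qContent (c.1 + 1, c.2) = q⁻¹ ^ 2 * qContent c := by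
      rw [qContent, qContent, inv_pow, ← zpow_natCast, ← zpow_neg, ← zpow_add₀ q_ne_zero]
      congr 1; simp only [content]; push_cast; ring
    have hright : (c.1, c.2 + 1) ∉ addable nu →
        (Y - qContent (c.1 + 1, c.2) • 1) * (aeval Y r * v) = 0 := by
      intro h
      obtain ⟨ka, d, hd, hdc, hcon⟩ := hc.exists_above h
      rw [hcb]
      refine key q rfl hq2 rfl ka d hd hdc (by omega) ?_
      rw [← hcr, qContent_eq_iff, hcon]
      simp only [content]; push_cast; ring
    have hbelow : (c.1 + 1, c.2) ∉ addable nu →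
        (Y - qContent (c.1, c.2 + 1) • 1) * (aeval Y r * v) = 0 := by
      intro h
      obtain ⟨ka, d, hd, hdc, hcon⟩ := hc.exists_left h
      have hk := key (-q⁻¹) (by rw [inv_neg_inv, eta]; ring) hq2'
        (by rw [inv_neg_inv]; ring) ka d hd hdc (by omega) (by
          rw [neg_sq, ← hcb, qContent_eq_iff, hcon]
          simp only [content]; push_cast; ring)
      rw [inv_neg_inv, neg_sq, ← hcr] at hk
      exact hk
    -- It suffices to find a set of addable cells whose contents annihilate `v`.
    suffices hS : ∃ S ⊆ addable nu, aeval Y (nodal S qContent) * v = 0 by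
      obtain ⟨S, hS, h0⟩ := hS
      rw [nodal, ← Finset.prod_sdiff hS, ← nodal, map_mul, mul_assoc, ← nodal, h0, mul_zero]
    have hR := hc.addable_erase_subset
    have hins : ∀ (e : ℕ × ℕ) (S : Finset (ℕ × ℕ)), e ∉ S →
        aeval Y (nodal (insert e S) qContent) =
          (Y - qContent e • 1) * aeval Y (nodal S qContent) := by
      intro e S he
      rw [Lagrange.nodal_insert_eq_nodal he, map_mul, map_sub, Polynomial.aeval_X,
        Polynomial.aeval_C, Algebra.algebraMap_eq_smul_one]
    have hnotR : ∀ e, c < e → e ∉ (addable mu).erase c := fun e hce he =>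
      hc.1 ((mem_addable_iff.1 (Finset.mem_of_mem_erase he)).2 c hce)
    have hcr' : c < (c.1, c.2 + 1) := Prod.lt_iff.2 (Or.inr ⟨le_rfl, Nat.lt_succ_self _⟩)
    have hcb' : c < (c.1 + 1, c.2) := Prod.lt_iff.2 (Or.inl ⟨Nat.lt_succ_self _, le_rfl⟩)
    by_cases hr' : (c.1, c.2 + 1) ∈ addable nu
    · by_cases hb' : (c.1 + 1, c.2) ∈ addable nu
      · refine ⟨insert (c.1, c.2 + 1) (insert (c.1 + 1, c.2) ((addable mu).erase c)),
          Finset.insert_subset hr' (Finset.insert_subset hb' hR), ?_⟩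
        rw [hins, hins _ _ (hnotR _ hcb'), mul_assoc, mul_assoc, ← hr, hcr, hcb]
        · have hqq : q ^ 2 * q⁻¹ ^ 2 = 1 := by field_simp [q_ne_zero]
          simp only [sub_mul, mul_sub, smul_mul_assoc, one_mul, mul_smul_comm, smul_sub, hquad]
          rw [smul_smul (q⁻¹ ^ 2 * qContent c), show q⁻¹ ^ 2 * qContent c * (q ^ 2 * qContent c) =
            q ^ 2 * q⁻¹ ^ 2 * qContent c ^ 2 by ring, hqq, one_mul]
          module
        · rw [Finset.mem_insert, not_or]
          refine ⟨fun h => ?_, hnotR _ hcr'⟩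
          rw [Prod.mk.injEq] at h; omega
      · refine ⟨insert (c.1, c.2 + 1) ((addable mu).erase c), Finset.insert_subset hr' hR, ?_⟩
        rw [hins _ _ (hnotR _ hcr'), mul_assoc]
        exact hbelow hb'
    · by_cases hb' : (c.1 + 1, c.2) ∈ addable nu
      · refine ⟨insert (c.1 + 1, c.2) ((addable mu).erase c), Finset.insert_subset hb' hR, ?_⟩
        rw [hins _ _ (hnotR _ hcb'), mul_assoc]
        exact hright hr'
      · refine ⟨_, hR, ?_⟩
        have e1 := hright hr'
        have e2 := hbelow hb'
        rw [sub_mul, smul_mul_assoc, one_mul] at e1 e2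
        have e3 : (qContent (c.1, c.2 + 1) - qContent (c.1 + 1, c.2)) • (aeval Y r * v) = 0 := by
          linear_combination (norm := module) e1 - e2
        refine (smul_eq_zero.1 e3).resolve_left (sub_ne_zero.2 fun h => ?_)
        rw [qContent_eq_iff] at h
        simp only [content] at h
        push_cast at h
        omega

end WeightVectors

/-! ### The idempotents attached to standard tableaux -/

section Idempotents

open Polynomial (aeval)
open Lagrange (nodal)

theorem basis_eq_C_mul_nodal {ι : Type*} [DecidableEq ι] (s : Finset ι) (v : ι → Kq) (i : ι) :
    Lagrange.basis s v i =
      Polynomial.C (∏ j ∈ s.erase i, (v i - v j)⁻¹) * nodal (s.erase i) v := by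
  rw [Lagrange.basis, nodal, map_prod, ← Finset.prod_mul_distrib]
  rfl

namespace StandardTableau

variable {n : ℕ} {lam : YoungDiagram} (t : StandardTableau n lam)

theorem mem_shape {k : ℕ} {c : ℕ × ℕ} :
    c ∈ t.shape k ↔ ∃ i : Fin n, i.1 < k ∧ (t.cell i).1 = c := by
  rw [← YoungDiagram.mem_cells]
  simp [shape]

theorem shape_zero : t.shape 0 = ⊥ := by
  ext c
  rw [YoungDiagram.mem_cells, mem_shape, YoungDiagram.cells_bot]
  simp

theorem shape_self : t.shape n = lam := by
  ext c
  rw [YoungDiagram.mem_cells, mem_shape]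
  constructor
  · rintro ⟨i, -, rfl⟩; exact (t.cell i).2
  · intro hc
    exact ⟨t.cell.symm ⟨c, hc⟩, (t.cell.symm ⟨c, hc⟩).2, by simp⟩

theorem isAdd_shape {k : ℕ} (h : k < n) :
    IsAdd (t.shape k) (t.cell ⟨k, h⟩).1 (t.shape (k + 1)) := by
  constructor
  · rw [mem_shape]
    rintro ⟨i, hi, he⟩
    have := t.cell.injective (Subtype.ext he)
    subst this
    exact lt_irrefl _ hi
  · ext c
    rw [Finset.mem_insert, YoungDiagram.mem_cells, YoungDiagram.mem_cells, mem_shape, mem_shape]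
    constructor
    · rintro ⟨i, hi, rfl⟩
      rcases Nat.lt_succ_iff_lt_or_eq.1 hi with hi | hi
      · exact Or.inr ⟨i, hi, rfl⟩
      · left; congr; exact Fin.ext hi
    · rintro (rfl | ⟨i, hi, rfl⟩)
      · exact ⟨_, Nat.lt_succ_self k, rfl⟩
      · exact ⟨i, by omega, rfl⟩

theorem card_shape {k : ℕ} (h : k ≤ n) : (t.shape k).card = k := by
  induction k with
  | zero => rw [shape_zero]; rfl
  | succ k ih => rw [(t.isAdd_shape h).card, ih (by omega)]

/-- The product of the idempotent of the first `k` entries of `t` and the Lagrange interpolation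
polynomial in `y_{k+1}` for the addable cell `c`: this is the idempotent of the tableau obtained
from the first `k` entries by adding the entry `k + 1` in the cell `c`. -/
def branch (k : ℕ) (c : ℕ × ℕ) : Hecke n :=
  t.idemAux k * aeval (jm n (k + 1)) (Lagrange.basis (addable (t.shape k)) qContent c)

theorem idemAux_succ {k : ℕ} (h : k < n) :
    t.idemAux (k + 1) = t.branch k (t.cell ⟨k, h⟩).1 := by
  rw [idemAux, dif_pos h]
  rfl

theorem commute_idemAux {z : Hecke n} {k : ℕ} (hk : k ≤ n)
    (h : ∀ i, 1 ≤ i → i < k → Commute z (T n i)) : Commute z (t.idemAux k) := by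
  induction k with
  | zero => exact Commute.one_right _
  | succ k ih =>
    rw [t.idemAux_succ hk]
    exact (ih (by omega) fun i hi hi' => h i hi (by omega)).mul_right
      (commute_aeval (commute_jm h) _)

theorem jm_commute_idemAux {j k : ℕ} (hj : j ≤ n) (hk : k ≤ n) :
    Commute (jm n j) (t.idemAux k) := by
  induction k with
  | zero => exact Commute.one_right _
  | succ k ih =>
    rw [t.idemAux_succ hk]
    exact (ih (by omega)).mul_right (commute_aeval (jm_commute hj hk) _)

theorem aeval_nodal_mul_idemAux {k : ℕ} (hk : k < n) (hw : Wt n (t.shape k) (t.idemAux k)) :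
    aeval (jm n (k + 1)) (nodal (addable (t.shape k)) qContent) * t.idemAux k = 0 := by
  have hcard := t.card_shape hk.le
  have := addableSpectrum (n := n) (t.shape k) (by omega) _ hw
  rwa [hcard] at this

theorem jm_mul_branch {k : ℕ} (hk : k < n) (hw : Wt n (t.shape k) (t.idemAux k)) {c : ℕ × ℕ}
    (hc : c ∈ addable (t.shape k)) :
    jm n (k + 1) * t.branch k c = qContent c • t.branch k c := by
  have h0 := t.aeval_nodal_mul_idemAux hk hw
  have hcomm := t.jm_commute_idemAux (j := k + 1) hk hk.le
  rw [← sub_eq_zero, branch, basis_eq_C_mul_nodal,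
    (commute_aeval hcomm.symm _).eq, ← mul_assoc, ← smul_mul_assoc, ← sub_mul]
  have : jm n (k + 1) * aeval (jm n (k + 1)) (Polynomial.C
        (∏ j ∈ (addable (t.shape k)).erase c, (qContent c - qContent j)⁻¹) *
          nodal ((addable (t.shape k)).erase c) qContent) -
      qContent c • aeval (jm n (k + 1)) (Polynomial.C
        (∏ j ∈ (addable (t.shape k)).erase c, (qContent c - qContent j)⁻¹) *
          nodal ((addable (t.shape k)).erase c) qContent) =
      aeval (jm n (k + 1)) (Polynomial.C
        (∏ j ∈ (addable (t.shape k)).erase c, (qContent c - qContent j)⁻¹) *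
          nodal (addable (t.shape k)) qContent) := by
    rw [Lagrange.nodal_eq_mul_nodal_erase hc, mul_left_comm, map_mul _ (_ - _), map_sub,
      Polynomial.aeval_X, Polynomial.aeval_C, sub_mul, ← Algebra.smul_def]
  rw [this, map_mul, mul_assoc, h0, mul_zero]

theorem wt_idemAux {k : ℕ} (hk : k ≤ n) : Wt n (t.shape k) (t.idemAux k) := by
  induction k with
  | zero => rw [shape_zero]; exact Wt.bot _
  | succ k ih =>
    have hw := ih (by omega)
    have hadd := t.isAdd_shape hk
    refine Wt.add ?_ hadd ?_
    · have hcomm := t.jm_commute_idemAux (j := k + 1) hk (by omega : k ≤ n)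
      rw [t.idemAux_succ hk, branch, (commute_aeval hcomm.symm _).eq]
      refine hw.mul_left fun j hj => ?_
      rw [t.card_shape (by omega)] at hj
      exact (commute_aeval (jm_commute (by omega) hk) _).symm
    · rw [t.card_shape hk, t.idemAux_succ hk]
      exact t.jm_mul_branch hk hw hadd.mem_addable

theorem jm_mul_idemAux {j k : ℕ} (hk : k ≤ n) (hj : j < k) :
    jm n (j + 1) * t.idemAux k = t.sigma ⟨j, by omega⟩ • t.idemAux k := by
  induction k with
  | zero => omega
  | succ k ih =>
    rw [t.idemAux_succ hk]
    rcases Nat.lt_succ_iff_lt_or_eq.1 hj with hj | rfl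
    · rw [branch, ← mul_assoc, ih (by omega) hj, smul_mul_assoc]
    · exact t.jm_mul_branch hk (t.wt_idemAux (by omega)) (t.isAdd_shape hk).mem_addable

theorem idemAux_mul_of_eigen {k : ℕ} (hk : k ≤ n) {v : Hecke n}
    (hv : ∀ j (hj : j < k), jm n (j + 1) * v = t.sigma ⟨j, by omega⟩ • v) :
    t.idemAux k * v = v := by
  induction k with
  | zero => exact one_mul v
  | succ k ih =>
    rw [t.idemAux_succ hk, branch, mul_assoc, aeval_mul_of_eigen (hv k (Nat.lt_succ_self k))]
    rw [show t.sigma ⟨k, hk⟩ = qContent (t.cell ⟨k, hk⟩).1 from rfl,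
      Lagrange.eval_basis_self (addable_qContent_injOn _) (t.isAdd_shape hk).mem_addable, one_smul]
    exact ih (by omega) fun j hj => hv j (by omega)

theorem idemAux_mul_self {k : ℕ} (hk : k ≤ n) : t.idemAux k * t.idemAux k = t.idemAux k :=
  t.idemAux_mul_of_eigen hk fun _ hj => t.jm_mul_idemAux hk hj

theorem idemAux_mul_succ {k : ℕ} (hk : k < n) :
    t.idemAux k * t.idemAux (k + 1) = t.idemAux (k + 1) :=
  t.idemAux_mul_of_eigen hk.le fun _ hj => t.jm_mul_idemAux hk (by omega)

theorem sum_branch (k : ℕ) : ∑ c ∈ addable (t.shape k), t.branch k c = t.idemAux k := by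
  simp only [branch]
  rw [← Finset.mul_sum, ← map_sum,
    Lagrange.sum_basis (addable_qContent_injOn _) (addable_nonempty _), map_one, mul_one]

end StandardTableau

end Idempotents

/-! ### Content products and hook lengths -/

theorem prod_telescope {L : Type*} [Field L] {f : ℤ → L} (hf : ∀ m, f m ≠ 0) (a : ℤ) (m : ℕ) :
    ∏ j ∈ Finset.range m, f (a + j + 1) * f (a + j - 1) / f (a + j) ^ 2 =
      (f (a + m) * f (a - 1)) / (f (a + m - 1) * f a) := by
  induction m with
  | zero =>
    have h1 := hf a
    have h2 := hf (a - 1)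
    simp only [Finset.range_zero, Finset.prod_empty, Nat.cast_zero, add_zero]
    field_simp
  | succ m ih =>
    rw [Finset.prod_range_succ, ih]
    have h1 := hf a
    have h2 := hf (a + m)
    have h3 := hf (a + m - 1)
    push_cast
    rw [show a + ((m : ℤ) + 1) - 1 = a + m by ring, show a + ((m : ℤ) + 1) = a + m + 1 by ring]
    field_simp

theorem prod_range_div_shift {L : Type*} [Field L] {f : ℤ → L} (hf : ∀ m, f m ≠ 0) (a : ℤ) (m : ℕ) :
    ∏ j ∈ Finset.range m, f (a + j + 1) / f (a + j) = f (a + m) / f a := by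
  induction m with
  | zero => simp [hf a]
  | succ m ih =>
    rw [Finset.prod_range_succ, ih]
    have h1 := hf a
    have h2 := hf (a + m)
    push_cast
    rw [show a + ((m : ℤ) + 1) = a + m + 1 by ring]
    field_simp

section ContentProducts

variable {L : Type*} [Field L] [Algebra Kq L]

/-- The difference `u - q^{2m}`. -/
def qSub (u : L) (m : ℤ) : L := u - algebraMap Kq L (q ^ (2 * m))

/-- The rational function
`(u - 1) ∏ (u - q² σ) (u - q⁻² σ) / (u - σ)²`, the product being over the `q`-contents `σ` of the
cells of `mu`. -/
def contentProd (mu : YoungDiagram) (u : L) : L :=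
  qSub u 0 * ∏ d ∈ mu.cells,
    qSub u (content d + 1) * qSub u (content d - 1) / qSub u (content d) ^ 2

/-- The function `contentProd mu u`, divided by `u - σ` where `σ` is the `q`-content of the
addable cell `c`, in a form which is regular at `u = σ`, see `contentProd_eq`. The denominators
come from the rows above and the columns to the left of `c`. -/
def addFactor (mu : YoungDiagram) (c : ℕ × ℕ) (u : L) : L :=
  (∏ i ∈ Finset.range c.1, qSub u (mu.rowLen i - i) / qSub u (mu.rowLen i - i - 1)) *
    ∏ j ∈ Finset.range c.2, qSub u (j - mu.colLen j) / qSub u (j - mu.colLen j + 1)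

theorem contentProd_bot (u : L) : contentProd ⊥ u = u - 1 := by
  simp [contentProd, qSub]

theorem IsAdd.contentProd {mu nu : YoungDiagram} {c : ℕ × ℕ} (h : IsAdd mu c nu) (u : L) :
    contentProd nu u = contentProd mu u *
      (qSub u (content c + 1) * qSub u (content c - 1) / qSub u (content c) ^ 2) := by
  rw [HeckeFusion.contentProd, HeckeFusion.contentProd, h.2,
    Finset.prod_insert (by simpa using h.1)]
  ring

theorem rowLen_of_mem_addable {mu : YoungDiagram} {c : ℕ × ℕ} (hc : c ∈ addable mu) :
    mu.rowLen c.1 = c.2 := by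
  obtain ⟨a, b⟩ := c
  rw [mem_addable_iff] at hc
  refine le_antisymm (not_lt.1 fun h => hc.1 (YoungDiagram.mem_iff_lt_rowLen.2 h)) ?_
  by_contra h
  have := hc.2 (a, mu.rowLen a) (by rw [Prod.mk_lt_mk]; simp at h; omega)
  exact lt_irrefl _ (YoungDiagram.mem_iff_lt_rowLen.1 this)

theorem colLen_of_mem_addable {mu : YoungDiagram} {c : ℕ × ℕ} (hc : c ∈ addable mu) :
    mu.colLen c.2 = c.1 := by
  obtain ⟨a, b⟩ := c
  rw [mem_addable_iff] at hc
  refine le_antisymm (not_lt.1 fun h => hc.1 (YoungDiagram.mem_iff_lt_colLen.2 h)) ?_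
  by_contra h
  have := hc.2 (mu.colLen b, b) (by rw [Prod.mk_lt_mk]; simp at h; omega)
  exact lt_irrefl _ (YoungDiagram.mem_iff_lt_colLen.1 this)

/-- The content product telescopes along the rows above the addable cell `c`, and along the
columns in the remaining part of the diagram. -/
theorem contentProd_eq {mu : YoungDiagram} {c : ℕ × ℕ} (hc : c ∈ addable mu) {u : L}
    (hu : ∀ m, qSub u m ≠ 0) :
    contentProd mu u = qSub u (content c) * addFactor mu c u := by
  have hrow := rowLen_of_mem_addable hc
  obtain ⟨a, b⟩ := c
  simp only at hrow
  set f := qSub u with hf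
  set g : ℕ × ℕ → L := fun d => f (content d + 1) * f (content d - 1) / f (content d) ^ 2 with hg
  have h1 : ∏ d ∈ mu.cells.filter (fun d => d.1 < a), g d =
      ∏ i ∈ Finset.range a, (f (mu.rowLen i - i) / f (mu.rowLen i - i - 1)) *
        (f (-i - 1) / f (-i)) := by
    rw [Finset.prod_finset_product _ (Finset.range a) (fun i => Finset.range (mu.rowLen i))]
    · refine Finset.prod_congr rfl fun i _ => ?_
      have := prod_telescope hu (-i) (mu.rowLen i)
      rw [div_mul_div_comm, show (mu.rowLen i : ℤ) - i = -i + mu.rowLen i by ring, ← this]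
      refine Finset.prod_congr rfl fun j _ => ?_
      simp only [hg, content, show (j : ℤ) - i = -i + j by ring]
    · rintro ⟨i, j⟩
      simp only [Finset.mem_filter, YoungDiagram.mem_cells, Finset.mem_range,
        YoungDiagram.mem_iff_lt_rowLen]
      tauto
  have h2 : ∏ d ∈ mu.cells.filter (fun d => ¬ d.1 < a), g d =
      ∏ j ∈ Finset.range b, (f (j - mu.colLen j) / f (j - mu.colLen j + 1)) *
        (f (-a + j + 1) / f (-a + j)) := by
    rw [Finset.prod_finset_product_right _ (Finset.range b)
      (fun j => Finset.Ico a (mu.colLen j))]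
    · refine Finset.prod_congr rfl fun j hj => ?_
      have hcol : a < mu.colLen j := by
        rw [← YoungDiagram.mem_iff_lt_colLen, YoungDiagram.mem_iff_lt_rowLen, hrow]
        exact Finset.mem_range.1 hj
      have := prod_telescope (f := fun m => f (-m)) (fun m => hu (-m)) (a - j)
        (mu.colLen j - a)
      rw [Nat.cast_sub hcol.le] at this
      rw [div_mul_div_comm, Finset.prod_Ico_eq_prod_range]
      have e1 : ∀ x : ℕ, g (a + x, j) = f (-(a - j + (x : ℤ) + 1)) * f (-(a - j + (x : ℤ) - 1)) /
          f (-(a - j + (x : ℤ))) ^ 2 := by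
        intro x
        simp only [hg, content]
        rw [mul_comm (f _) (f _)]
        push_cast
        congr 3 <;> ring_nf
      rw [Finset.prod_congr rfl fun x _ => e1 x, this]
      congr 3 <;> ring_nf
    · rintro ⟨i, j⟩
      simp only [Finset.mem_filter, YoungDiagram.mem_cells, Finset.mem_range, Finset.mem_Ico,
        not_lt]
      constructor
      · rintro ⟨h, hi⟩
        refine ⟨?_, hi, YoungDiagram.mem_iff_lt_colLen.1 h⟩
        have := YoungDiagram.mem_iff_lt_rowLen.1 h
        exact lt_of_lt_of_le this (hrow ▸ mu.rowLen_anti a i hi)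
      · rintro ⟨-, hi, h⟩
        exact ⟨YoungDiagram.mem_iff_lt_colLen.2 h, hi⟩
  have h3 := prod_range_div_shift (f := f) hu (-a) b
  have h4 := prod_range_div_shift (f := fun m => f (-m)) (fun m => hu (-m)) 0 a
  simp only [zero_add, neg_zero, neg_add, ← sub_eq_add_neg] at h4
  rw [contentProd, ← Finset.prod_filter_mul_prod_filter_not mu.cells (fun d => d.1 < a), h1, h2,
    Finset.prod_mul_distrib, Finset.prod_mul_distrib, h3, h4, addFactor, ← hf, content]
  have h0 := hu 0
  have ha := hu (-a)
  rw [show (b : ℤ) - a = -a + b by ring]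
  field_simp

end ContentProducts

theorem qNumber_ne_zero {m : ℤ} (hm : m ≠ 0) : qNumber m ≠ 0 := by
  rw [qNumber]
  refine div_ne_zero (sub_ne_zero.2 fun h => hm ?_) eta_ne_zero
  have := q_zpow_injective h
  omega

theorem q_zpow_sub (x y : ℤ) :
    q ^ (2 * x) - q ^ (2 * y) = q ^ (x + y) * eta * qNumber (x - y) := by
  have h := eta_ne_zero
  rw [qNumber, ← eta, mul_assoc, mul_div_cancel₀ _ h, mul_sub, ← zpow_add₀ q_ne_zero,
    ← zpow_add₀ q_ne_zero]
  congr 2 <;> ring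

theorem qNumber_neg (m : ℤ) : qNumber (-m) = -qNumber m := by
  rw [qNumber, qNumber, neg_neg, ← neg_div, neg_sub]

section Hooks

variable {mu nu : YoungDiagram} {c : ℕ × ℕ}

theorem hook_pos {d : ℕ × ℕ} (hd : d ∈ mu) : 0 < hook mu d := by
  obtain ⟨i, j⟩ := d
  have h1 := YoungDiagram.mem_iff_lt_rowLen.1 hd
  have h2 := YoungDiagram.mem_iff_lt_colLen.1 hd
  simp only [hook]
  omega

theorem IsAdd.rowLen (h : IsAdd mu c nu) (i : ℕ) :
    nu.rowLen i = mu.rowLen i + if i = c.1 then 1 else 0 := by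
  have key : ∀ j, j < nu.rowLen i ↔ (i, j) = c ∨ j < mu.rowLen i := fun j => by
    rw [← YoungDiagram.mem_iff_lt_rowLen, ← YoungDiagram.mem_iff_lt_rowLen, h.mem_iff]
  have hrow := rowLen_of_mem_addable h.mem_addable
  obtain ⟨a, b⟩ := c
  simp only [Prod.mk.injEq] at key hrow ⊢
  have k1 := key (nu.rowLen i)
  have k2 := key (mu.rowLen i)
  have k3 := key (mu.rowLen i + 1)
  split_ifs with hi
  · subst hi; omega
  · omega

theorem IsAdd.colLen (h : IsAdd mu c nu) (j : ℕ) :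
    nu.colLen j = mu.colLen j + if j = c.2 then 1 else 0 := by
  have key : ∀ i, i < nu.colLen j ↔ (i, j) = c ∨ i < mu.colLen j := fun i => by
    rw [← YoungDiagram.mem_iff_lt_colLen, ← YoungDiagram.mem_iff_lt_colLen, h.mem_iff]
  have hcol := colLen_of_mem_addable h.mem_addable
  obtain ⟨a, b⟩ := c
  simp only [Prod.mk.injEq] at key hcol ⊢
  have k1 := key (nu.colLen j)
  have k2 := key (mu.colLen j)
  have k3 := key (mu.colLen j + 1)
  split_ifs with hj
  · subst hj; omega
  · omega

theorem IsAdd.hook_self (h : IsAdd mu c nu) : hook nu c = 1 := by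
  have h1 := rowLen_of_mem_addable h.mem_addable
  have h2 := colLen_of_mem_addable h.mem_addable
  rw [hook, h.rowLen, h.colLen, h1, h2, if_pos rfl, if_pos rfl]
  push_cast; ring

theorem prod_row (mu : YoungDiagram) (a : ℕ) (g : ℕ × ℕ → Kq) :
    ∏ d ∈ mu.cells, (if d.1 = a then g d else 1) = ∏ j ∈ Finset.range (mu.rowLen a), g (a, j) := by
  rw [← Finset.prod_filter]
  have := mu.row_eq_prod (i := a)
  rw [YoungDiagram.row] at this
  rw [this, Finset.prod_product, Finset.prod_singleton]

theorem prod_col (mu : YoungDiagram) (b : ℕ) (g : ℕ × ℕ → Kq) :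
    ∏ d ∈ mu.cells, (if d.2 = b then g d else 1) = ∏ i ∈ Finset.range (mu.colLen b), g (i, b) := by
  rw [← Finset.prod_filter]
  have := mu.col_eq_prod (j := b)
  rw [YoungDiagram.col] at this
  rw [this, Finset.prod_product_right, Finset.prod_singleton]

/-- The ratio of the normalization factors of two diagrams differing by one cell, expressed
through contents. Only the hooks in the row and in the column of the new cell change. -/
theorem IsAdd.normFactor (h : IsAdd mu c nu) :
    normFactor nu * addFactor mu c (qContent c) = normFactor mu := by
  have hrow := rowLen_of_mem_addable h.mem_addable
  have hcol := colLen_of_mem_addable h.mem_addable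
  have hR := h.rowLen
  have hC := h.colLen
  have hself := h.hook_self
  obtain ⟨a, b⟩ := c
  simp only at hrow hcol hR hC
  set g : ℕ × ℕ → Kq := fun d => qNumber (hook mu d) / qNumber (hook mu d + 1) with hg
  have hratio : ∀ d ∈ mu.cells, q ^ content d / qNumber (hook nu d) =
      q ^ content d / qNumber (hook mu d) *
        ((if d.1 = a then g d else 1) * (if d.2 = b then g d else 1)) := by
    intro d hd
    have hpos := hook_pos ((YoungDiagram.mem_cells d).1 hd)
    have e0 := qNumber_ne_zero hpos.ne'
    have e1 := qNumber_ne_zero (show hook mu d + 1 ≠ 0 by omega)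
    by_cases h1 : d.1 = a
    · have h2 : d.2 ≠ b := by
        rintro rfl
        exact h.1 (by rw [← h1]; exact (YoungDiagram.mem_cells d).1 hd)
      have : hook nu d = hook mu d + 1 := by
        rw [hook, hook, hR, hC, if_pos h1, if_neg h2]; push_cast; ring
      rw [this, if_pos h1, if_neg h2, hg]
      field_simp
    · by_cases h2 : d.2 = b
      · have : hook nu d = hook mu d + 1 := by
          rw [hook, hook, hR, hC, if_neg h1, if_pos h2]; push_cast; ring
        rw [this, if_neg h1, if_pos h2, hg]
        field_simp
      · have : hook nu d = hook mu d := by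
          rw [hook, hook, hR, hC, if_neg h1, if_neg h2]; push_cast; ring
        rw [this, if_neg h1, if_neg h2]
        ring
  have hmu : HeckeFusion.normFactor nu = q ^ ((b : ℤ) - a) * (HeckeFusion.normFactor mu *
      ((∏ j ∈ Finset.range b, g (a, j)) * ∏ i ∈ Finset.range a, g (i, b))) := by
    rw [HeckeFusion.normFactor, h.2, Finset.prod_insert (by simpa using h.1), hself,
      Finset.prod_congr rfl hratio, Finset.prod_mul_distrib, Finset.prod_mul_distrib, prod_row,
      prod_col, hrow, hcol, HeckeFusion.normFactor, content]
    have : qNumber 1 = 1 := by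
      rw [qNumber, zpow_one, zpow_neg_one]
      exact div_self eta_ne_zero
    rw [this, div_one]
  have hrows : ∏ j ∈ Finset.range b, (g (a, j) *
      (qSub (qContent (a, b)) (j - mu.colLen j) / qSub (qContent (a, b)) (j - mu.colLen j + 1))) =
      ∏ j ∈ Finset.range b, q⁻¹ := by
    refine Finset.prod_congr rfl fun j hj => ?_
    have hmem : (a, j) ∈ mu := by
      rw [YoungDiagram.mem_iff_lt_rowLen, hrow]; exact Finset.mem_range.1 hj
    have hpos := hook_pos hmem
    have hh : hook mu (a, j) = b + mu.colLen j - a - j - 1 := by rw [hook, hrow]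
    have e0 := qNumber_ne_zero hpos.ne'
    have e1 := qNumber_ne_zero (show hook mu (a, j) + 1 ≠ 0 by omega)
    have e2 := eta_ne_zero
    have e3 := q_ne_zero
    simp only [hg, qSub, qContent, Algebra.algebraMap_self, RingHom.id_apply]
    rw [q_zpow_sub, q_zpow_sub]
    rw [show content (a, b) - ((j : ℤ) - mu.colLen j) = hook mu (a, j) + 1 by
      rw [hh, content]; ring, show content (a, b) - ((j : ℤ) - mu.colLen j + 1) = hook mu (a, j) by
      rw [hh, content]; ring, ← add_assoc, zpow_add_one₀ q_ne_zero]
    have e4 := zpow_ne_zero (content (a, b) + ((j : ℤ) - mu.colLen j)) q_ne_zero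
    field_simp
  have hcols : ∏ i ∈ Finset.range a, (g (i, b) *
      (qSub (qContent (a, b)) (mu.rowLen i - i) / qSub (qContent (a, b)) (mu.rowLen i - i - 1))) =
      ∏ i ∈ Finset.range a, q := by
    refine Finset.prod_congr rfl fun i hi => ?_
    have hmem : (i, b) ∈ mu := by
      rw [YoungDiagram.mem_iff_lt_colLen, hcol]; exact Finset.mem_range.1 hi
    have hpos := hook_pos hmem
    have hh : hook mu (i, b) = mu.rowLen i + a - i - b - 1 := by rw [hook, hcol]
    have e0 := qNumber_ne_zero hpos.ne'
    have e1 := qNumber_ne_zero (show hook mu (i, b) + 1 ≠ 0 by omega)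
    have e2 := eta_ne_zero
    have e3 := q_ne_zero
    simp only [hg, qSub, qContent, Algebra.algebraMap_self, RingHom.id_apply]
    rw [q_zpow_sub, q_zpow_sub]
    rw [show content (a, b) - ((mu.rowLen i : ℤ) - i) = -(hook mu (i, b) + 1) by
      rw [hh, content]; ring, show content (a, b) - ((mu.rowLen i : ℤ) - i - 1) =
        -(hook mu (i, b)) by rw [hh, content]; ring, qNumber_neg, qNumber_neg,
      show content (a, b) + ((mu.rowLen i : ℤ) - i) =
        content (a, b) + ((mu.rowLen i : ℤ) - i - 1) + 1 by ring, zpow_add_one₀ q_ne_zero]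
    have e4 := zpow_ne_zero (content (a, b) + ((mu.rowLen i : ℤ) - i - 1)) q_ne_zero
    field_simp
  rw [Finset.prod_mul_distrib, Finset.prod_const, Finset.card_range] at hrows hcols
  have hpow : q ^ ((b : ℤ) - a) * (q⁻¹ ^ b * q ^ a) = 1 := by
    have e3 := q_ne_zero
    rw [zpow_sub₀ e3, zpow_natCast, zpow_natCast, inv_pow]
    field_simp
  rw [hmu, addFactor]
  simp only
  rw [← hrows, ← hcols] at hpow
  linear_combination (HeckeFusion.normFactor mu) * hpow

end Hooks

theorem normFactor_ne_zero (mu : YoungDiagram) : normFactor mu ≠ 0 := by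
  refine Finset.prod_ne_zero_iff.2 fun d hd => div_ne_zero (zpow_ne_zero _ q_ne_zero) ?_
  exact qNumber_ne_zero (hook_pos ((YoungDiagram.mem_cells d).1 hd)).ne'

/-- The denominators of `addFactor mu c` do not vanish at the `q`-content of `c`. -/
theorem qSub_qContent_ne_zero {mu : YoungDiagram} {c : ℕ × ℕ} (hc : c ∈ addable mu) :
    (∀ i < c.1, qSub (qContent c) (mu.rowLen i - i - 1) ≠ 0) ∧
      ∀ j < c.2, qSub (qContent c) (j - mu.colLen j + 1) ≠ 0 := by
  have hrow := rowLen_of_mem_addable hc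
  have hcol := colLen_of_mem_addable hc
  have key : ∀ m, content c ≠ m → qSub (qContent c) m ≠ 0 := by
    intro m hm h
    have := q_zpow_injective (sub_eq_zero.1 h)
    omega
  obtain ⟨a, b⟩ := c
  simp only at hrow hcol ⊢
  constructor
  · intro i hi
    have : (i, b) ∈ mu := by rw [YoungDiagram.mem_iff_lt_colLen, hcol]; exact hi
    rw [YoungDiagram.mem_iff_lt_rowLen] at this
    refine key _ ?_
    rw [content]
    simp only
    omega
  · intro j hj
    have : (a, j) ∈ mu := by rw [YoungDiagram.mem_iff_lt_rowLen, hrow]; exact hj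
    rw [YoungDiagram.mem_iff_lt_colLen] at this
    refine key _ ?_
    rw [content]
    simp only
    omega

/-! ### Evaluation of rational functions -/

section Evaluation

variable {n : ℕ} {k : Fin n} {s : Kq}

theorem algebraMap_poly_ne_zero {p : Poly n} (hp : p ≠ 0) : algebraMap (Poly n) (Rat n) p ≠ 0 :=
  (map_ne_zero_iff _ (IsFractionRing.injective (Poly n) (Rat n))).2 hp

theorem ne_zero_of_subst {b : Poly n} (hb : subst n k s b ≠ 0) : b ≠ 0 := fun h0 =>
  hb (by rw [h0, map_zero])

/-- The scalar rational function `r` is regular at `u_k = s`, with value `r'` there. -/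
def ScalarEval (n : ℕ) (k : Fin n) (s : Kq) (r r' : Rat n) : Prop :=
  ∃ a b : Poly n, subst n k s b ≠ 0 ∧
    r = algebraMap (Poly n) (Rat n) a / algebraMap (Poly n) (Rat n) b ∧
    r' = algebraMap (Poly n) (Rat n) (subst n k s a) / algebraMap (Poly n) (Rat n) (subst n k s b)

theorem ScalarEval.of_poly (a : Poly n) :
    ScalarEval n k s (algebraMap (Poly n) (Rat n) a)
      (algebraMap (Poly n) (Rat n) (subst n k s a)) :=
  ⟨a, 1, by rw [map_one]; exact one_ne_zero, by simp, by simp⟩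

theorem ScalarEval.constant (c : Kq) :
    ScalarEval n k s (algebraMap Kq (Rat n) c) (algebraMap Kq (Rat n) c) := by
  have h := ScalarEval.of_poly (n := n) (k := k) (s := s) (algebraMap Kq (Poly n) c)
  rwa [AlgHom.commutes, ← IsScalarTower.algebraMap_apply] at h

theorem ScalarEval.u_self : ScalarEval n k s (u n k) (algebraMap Kq (Rat n) s) := by
  have h := ScalarEval.of_poly (n := n) (k := k) (s := s) (MvPolynomial.X k)
  rw [subst, MvPolynomial.aeval_X, Function.update_self, ← MvPolynomial.algebraMap_eq,
    ← IsScalarTower.algebraMap_apply] at h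
  exact h

theorem ScalarEval.u_of_ne {m : Fin n} (hm : m ≠ k) : ScalarEval n k s (u n m) (u n m) := by
  have h := ScalarEval.of_poly (n := n) (k := k) (s := s) (MvPolynomial.X m)
  rw [subst, MvPolynomial.aeval_X, Function.update_of_ne hm] at h
  exact h

theorem ScalarEval.add {r₁ r₁' r₂ r₂' : Rat n} (h₁ : ScalarEval n k s r₁ r₁')
    (h₂ : ScalarEval n k s r₂ r₂') : ScalarEval n k s (r₁ + r₂) (r₁' + r₂') := by
  obtain ⟨a, b, hb, rfl, rfl⟩ := h₁
  obtain ⟨a', b', hb', rfl, rfl⟩ := h₂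
  refine ⟨a * b' + b * a', b * b', by rw [map_mul]; exact mul_ne_zero hb hb', ?_, ?_⟩
  · rw [div_add_div _ _ (algebraMap_poly_ne_zero (ne_zero_of_subst hb))
      (algebraMap_poly_ne_zero (ne_zero_of_subst hb')), map_mul, map_add, map_mul, map_mul]
  · rw [div_add_div _ _ (algebraMap_poly_ne_zero hb) (algebraMap_poly_ne_zero hb')]
    simp only [map_mul, map_add]

theorem ScalarEval.mul {r₁ r₁' r₂ r₂' : Rat n} (h₁ : ScalarEval n k s r₁ r₁')
    (h₂ : ScalarEval n k s r₂ r₂') : ScalarEval n k s (r₁ * r₂) (r₁' * r₂') := by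
  obtain ⟨a, b, hb, rfl, rfl⟩ := h₁
  obtain ⟨a', b', hb', rfl, rfl⟩ := h₂
  refine ⟨a * a', b * b', by rw [map_mul]; exact mul_ne_zero hb hb', ?_, ?_⟩ <;>
  · rw [div_mul_div_comm]
    simp only [map_mul]

theorem ScalarEval.sub {r₁ r₁' r₂ r₂' : Rat n} (h₁ : ScalarEval n k s r₁ r₁')
    (h₂ : ScalarEval n k s r₂ r₂') : ScalarEval n k s (r₁ - r₂) (r₁' - r₂') := by
  have h := h₁.add ((ScalarEval.constant (-1)).mul h₂)
  rw [map_neg, map_one, neg_one_mul, neg_one_mul, ← sub_eq_add_neg, ← sub_eq_add_neg] at h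
  exact h

theorem ScalarEval.inv {r r' : Rat n} (h : ScalarEval n k s r r') (h0 : r' ≠ 0) :
    ScalarEval n k s r⁻¹ r'⁻¹ := by
  obtain ⟨a, b, hb, rfl, rfl⟩ := h
  refine ⟨b, a, fun ha => h0 (by rw [ha, map_zero, zero_div]), by rw [inv_div], by rw [inv_div]⟩

theorem ScalarEval.div {r₁ r₁' r₂ r₂' : Rat n} (h₁ : ScalarEval n k s r₁ r₁')
    (h₂ : ScalarEval n k s r₂ r₂') (h0 : r₂' ≠ 0) :
    ScalarEval n k s (r₁ / r₂) (r₁' / r₂') := by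
  rw [div_eq_mul_inv, div_eq_mul_inv]
  exact h₁.mul (h₂.inv h0)

theorem ScalarEval.one : ScalarEval n k s 1 1 := by
  simpa using ScalarEval.constant (n := n) (k := k) (s := s) 1

theorem ScalarEval.prod {ι : Type*} {S : Finset ι} {f f' : ι → Rat n}
    (h : ∀ i ∈ S, ScalarEval n k s (f i) (f' i)) :
    ScalarEval n k s (∏ i ∈ S, f i) (∏ i ∈ S, f' i) := by
  classical
  induction S using Finset.induction_on with
  | empty => exact ScalarEval.one
  | insert a S ha ih =>
    rw [Finset.prod_insert ha, Finset.prod_insert ha]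
    exact (h a (Finset.mem_insert_self a S)).mul
      (ih fun i hi => h i (Finset.mem_insert_of_mem hi))

theorem EvaluatesTo.mul {F₁ G₁ F₂ G₂ : RatHecke n} (h₁ : EvaluatesTo n k s F₁ G₁)
    (h₂ : EvaluatesTo n k s F₂ G₂) : EvaluatesTo n k s (F₁ * F₂) (G₁ * G₂) := by
  obtain ⟨A, b, hb, rfl, rfl⟩ := h₁
  obtain ⟨A', b', hb', rfl, rfl⟩ := h₂
  refine ⟨A * A', b * b', by rw [map_mul]; exact mul_ne_zero hb hb', ?_, ?_⟩ <;>
  · rw [smul_mul_smul_comm]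
    simp only [map_mul, mul_inv]

theorem EvaluatesTo.add {F₁ G₁ F₂ G₂ : RatHecke n} (h₁ : EvaluatesTo n k s F₁ G₁)
    (h₂ : EvaluatesTo n k s F₂ G₂) : EvaluatesTo n k s (F₁ + F₂) (G₁ + G₂) := by
  obtain ⟨A, b, hb, rfl, rfl⟩ := h₁
  obtain ⟨A', b', hb', rfl, rfl⟩ := h₂
  have n1 := algebraMap_poly_ne_zero (ne_zero_of_subst hb)
  have n2 := algebraMap_poly_ne_zero (ne_zero_of_subst hb')
  have n3 := algebraMap_poly_ne_zero hb
  have n4 := algebraMap_poly_ne_zero hb'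
  refine ⟨b' • A + b • A', b * b', by rw [map_mul]; exact mul_ne_zero hb hb', ?_, ?_⟩
  · rw [map_add, toRatHecke_smul, toRatHecke_smul, smul_add, smul_smul, smul_smul, map_mul]
    congr 2 <;> field_simp
  · rw [map_add, substHecke_smul, substHecke_smul, map_add, toRatHecke_smul, toRatHecke_smul,
      smul_add, smul_smul, smul_smul, map_mul, map_mul]
    congr 2 <;> field_simp

theorem EvaluatesTo.const (h : Hecke n) : EvaluatesTo n k s (const n h) (const n h) := by
  refine ⟨1 ⊗ₜ h, 1, by rw [map_one]; exact one_ne_zero, ?_, ?_⟩ <;>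
  simp [HeckeFusion.const, toRatHecke, substHecke]

theorem ScalarEval.evaluatesTo {r r' : Rat n} (h : ScalarEval n k s r r') :
    EvaluatesTo n k s (algebraMap (Rat n) (RatHecke n) r)
      (algebraMap (Rat n) (RatHecke n) r') := by
  obtain ⟨a, b, hb, rfl, rfl⟩ := h
  refine ⟨a ⊗ₜ 1, b, hb, ?_, ?_⟩ <;>
  simp [Algebra.TensorProduct.algebraMap_apply, toRatHecke, substHecke, TensorProduct.smul_tmul',
    div_eq_inv_mul]

theorem EvaluatesTo.sum {ι : Type*} {S : Finset ι} {F G : ι → RatHecke n}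
    (h : ∀ i ∈ S, EvaluatesTo n k s (F i) (G i)) :
    EvaluatesTo n k s (∑ i ∈ S, F i) (∑ i ∈ S, G i) := by
  classical
  induction S using Finset.induction_on with
  | empty =>
    have := EvaluatesTo.const (n := n) (k := k) (s := s) 0
    simpa [HeckeFusion.const] using this
  | insert a S ha ih =>
    rw [Finset.sum_insert ha, Finset.sum_insert ha]
    exact (h a (Finset.mem_insert_self a S)).add
      (ih fun i hi => h i (Finset.mem_insert_of_mem hi))

theorem evaluatesTo_baxterT (i : ℕ) {x x' y y' : Rat n} (hx : ScalarEval n k s x x')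
    (hy : ScalarEval n k s y y') (hx0 : x' ≠ 0) (hxy : x' ≠ y') :
    EvaluatesTo n k s (baxterT n i x y) (baxterT n i x' y') := by
  refine (EvaluatesTo.const _).add (ScalarEval.evaluatesTo ?_)
  refine (ScalarEval.constant _).div (((hx.inv hx0).mul hy).sub ScalarEval.one) ?_
  rw [sub_ne_zero]
  intro h
  exact hxy (by rw [← mul_inv_cancel_left₀ hx0 y', h, mul_one])

end Evaluation

/-- Constants of the Hecke algebra as rational functions, as a homomorphism of algebras. -/
def constHom (n : ℕ) : Hecke n →ₐ[Kq] RatHecke n := Algebra.TensorProduct.includeRight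

theorem const_eq_constHom (n : ℕ) (h : Hecke n) : const n h = constHom n h := rfl

theorem constHom_smul (n : ℕ) (a : Kq) (h : Hecke n) :
    constHom n (a • h) = algebraMap Kq (Rat n) a • constHom n h := by
  rw [map_smul, algebraMap_smul]

/-! ### The Yang–Baxter equation and exchange of the spectral parameter -/

theorem yangBaxter_aux {R A : Type*} [CommRing R] [Ring A] [Algebra R A] {a b : A} {e x y z : R}
    (hab : a * b * a = b * a * b) (ha : a * a = 1 + e • a) (hb : b * b = 1 + e • b)
    (h : x * z = y * (e + x + z)) :
    (a + algebraMap R A x) * (b + algebraMap R A y) * (a + algebraMap R A z) =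
      (b + algebraMap R A z) * (a + algebraMap R A y) * (b + algebraMap R A x) := by
  simp only [Algebra.algebraMap_eq_smul_one, add_mul, mul_add, smul_mul_assoc, mul_smul_comm,
    one_mul, mul_one, ha, hb, hab]
  linear_combination (norm := module) h • (b - a)

section YangBaxter

variable {n : ℕ}

/-- The scalar part of the rational function `T_i(x, y)`. -/
def baxterScalar (n : ℕ) (x y : Rat n) : Rat n :=
  algebraMap Kq (Rat n) eta / (x⁻¹ * y - 1)

theorem baxterT_eq (i : ℕ) (x y : Rat n) : baxterT n i x y =
    constHom n (T n i) + algebraMap (Rat n) (RatHecke n) (baxterScalar n x y) := rfl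

theorem baxterScalar_eq {x y : Rat n} (hx : x ≠ 0) :
    baxterScalar n x y = algebraMap Kq (Rat n) eta * x / (y - x) := by
  rw [baxterScalar]
  by_cases hxy : y - x = 0
  · have : x⁻¹ * y - 1 = 0 := by
      rw [sub_eq_zero.1 hxy, inv_mul_cancel₀ hx, sub_self]
    rw [hxy, this, div_zero, div_zero]
  · have : x⁻¹ * y - 1 = (y - x) / x := by field_simp
    rw [this, div_div_eq_mul_div]

theorem constHom_T_quad {i : ℕ} (h1 : 1 ≤ i) (h2 : i < n) :
    constHom n (T n i) * constHom n (T n i) =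
      1 + algebraMap Kq (Rat n) eta • constHom n (T n i) := by
  rw [← map_mul, T_quad h1 h2, map_add, map_one, constHom_smul]

theorem yangBaxter {i : ℕ} (h1 : 1 ≤ i) (h2 : i + 1 < n) {x v w : Rat n} (hx : x ≠ 0) (hv : v ≠ 0)
    (hxv : v ≠ x) (hxw : w ≠ x) (hvw : w ≠ v) :
    baxterT n i x v * baxterT n (i + 1) x w * baxterT n i v w =
      baxterT n (i + 1) v w * baxterT n i x w * baxterT n (i + 1) x v := by
  simp only [baxterT_eq]
  refine yangBaxter_aux (e := algebraMap Kq (Rat n) eta) ?_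
    (constHom_T_quad h1 (by omega)) (constHom_T_quad (by omega) h2) ?_
  · simp only [← map_mul]
    rw [T_braid h1 h2]
  · rw [baxterScalar_eq hx, baxterScalar_eq hx, baxterScalar_eq hv]
    have e1 := sub_ne_zero.2 hxv
    have e2 := sub_ne_zero.2 hxw
    have e3 := sub_ne_zero.2 hvw
    field_simp
    ring

theorem commute_baxterT {z : RatHecke n} {i : ℕ} (h : Commute z (constHom n (T n i)))
    (x y : Rat n) : Commute z (baxterT n i x y) :=
  h.add_right (Algebra.commute_algebraMap_right _ _)

/-- The product `T_a(x_0, v) T_{a-1}(x_1, v) ⋯ T_{a-l+1}(x_{l-1}, v)`. -/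
def block (n : ℕ) (x : ℕ → Rat n) (v : Rat n) (a : ℕ) : ℕ → RatHecke n
  | 0 => 1
  | l + 1 => block n x v a l * baxterT n (a - l) (x l) v

/-- The product `T_k(x_{k-1}, v) T_{k-1}(x_{k-2}, v) ⋯ T_1(x_0, v)`. -/
def revBlock (n : ℕ) (x : ℕ → Rat n) (v : Rat n) : ℕ → RatHecke n
  | 0 => 1
  | k + 1 => baxterT n (k + 1) (x k) v * revBlock n x v k

/-- The product of the blocks of the variables `x_j, …, x_{j+l-1}`. -/
def blockProd (n : ℕ) (x : ℕ → Rat n) (j : ℕ) : ℕ → RatHecke n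
  | 0 => 1
  | l + 1 => blockProd n x j l * block n x (x (j + l)) (j + l) (j + l)

theorem commute_block {z : RatHecke n} {a l : ℕ} (hl : l ≤ a)
    (h : ∀ i, a - l < i → i ≤ a → Commute z (constHom n (T n i))) (x : ℕ → Rat n) (v : Rat n) :
    Commute z (block n x v a l) := by
  induction l with
  | zero => exact Commute.one_right _
  | succ l ih =>
    exact (ih (by omega) fun i hi hi' => h i (by omega) hi').mul_right
      (commute_baxterT (h _ (by omega) (by omega)) _ _)

theorem commute_blockProd {z : RatHecke n} {j l : ℕ}
    (h : ∀ i, 1 ≤ i → i < j + l → Commute z (constHom n (T n i))) (x : ℕ → Rat n) :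
    Commute z (blockProd n x j l) := by
  induction l with
  | zero => exact Commute.one_right _
  | succ l ih =>
    exact (ih fun i hi hi' => h i hi (by omega)).mul_right
      (commute_block le_rfl (fun i hi hi' => h i (by omega) (by omega)) _ _)

theorem block_mul_block {x : ℕ → Rat n} {v w : Rat n} {k : ℕ} (hk : k + 1 < n) (hv : v ≠ 0)
    (hvw : w ≠ v) (hx : ∀ i < k, x i ≠ 0 ∧ v ≠ x i ∧ w ≠ x i) {l : ℕ} (hl : l ≤ k) :
    block n x v k l * block n x w (k + 1) l * baxterT n (k + 1 - l) v w =
      baxterT n (k + 1) v w * block n x w k l * block n x v (k + 1) l := by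
  induction l with
  | zero => simp [block]
  | succ l ih =>
    obtain ⟨i, rfl⟩ : ∃ i, k = i + 1 + l := ⟨k - 1 - l, by omega⟩
    have hxl := hx l (by omega)
    have ih := ih (by omega)
    have e1 : i + 1 + l - l = i + 1 := by omega
    have e2 : i + 1 + l + 1 - l = i + 1 + 1 := by omega
    have e3 : i + 1 + l + 1 - (l + 1) = i + 1 := by omega
    rw [e2] at ih
    simp only [block, e1, e2, e3]
    have hyb := yangBaxter (n := n) (i := i + 1) (by omega) (by omega) hxl.1 hv hxl.2.1 hxl.2.2 hvw
    have c : ∀ (z y y' : Rat n), Commute (baxterT n (i + 1) y y')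
        (block n x z (i + 1 + l + 1) l) := fun z y y' =>
      commute_block (by omega) (fun m hm hm' =>
        (commute_baxterT ((T_comm (by omega)).map (constHom n)) _ _).symm) _ _
    have c1 := c w (x l) v
    have c2 := c v (x l) w
    generalize block n x v (i + 1 + l) l = A at *
    generalize block n x w (i + 1 + l) l = A' at *
    generalize block n x v (i + 1 + l + 1) l = B' at *
    generalize block n x w (i + 1 + l + 1) l = B at *
    calc A * baxterT n (i + 1) (x l) v * (B * baxterT n (i + 1 + 1) (x l) w) *
          baxterT n (i + 1) v w
        = A * (baxterT n (i + 1) (x l) v * B) * baxterT n (i + 1 + 1) (x l) w *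
          baxterT n (i + 1) v w := by simp only [mul_assoc]
      _ = A * B * (baxterT n (i + 1) (x l) v * baxterT n (i + 1 + 1) (x l) w *
          baxterT n (i + 1) v w) := by rw [c1.eq]; simp only [mul_assoc]
      _ = (A * B * baxterT n (i + 1 + 1) v w) * baxterT n (i + 1) (x l) w *
          baxterT n (i + 1 + 1) (x l) v := by rw [hyb]; simp only [mul_assoc]
      _ = baxterT n (i + 1 + l + 1) v w * A' * (B' * baxterT n (i + 1) (x l) w) *
          baxterT n (i + 1 + 1) (x l) v := by rw [ih]; simp only [mul_assoc]
      _ = _ := by rw [← c2.eq]; simp only [mul_assoc]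

/-- The product `T_k ⋯ T_1` conjugates `T_{i+1}` to `T_i`. -/
theorem descProd_mul_T {a i : ℕ} (hi : 1 ≤ i) (hia : i + 1 ≤ a) (ha : a < n) :
    (descProd n a : Hecke n) * T n (i + 1) = T n i * descProd n a := by
  induction a with
  | zero => omega
  | succ a ih =>
    simp only [descProd, Units.val_mul]
    rcases (show i = a ∨ i + 1 ≤ a by omega) with rfl | hia'
    · obtain ⟨i, rfl⟩ : ∃ m, i = m + 1 := ⟨i - 1, by omega⟩
      simp only [descProd, Units.val_mul]
      have hb := T_braid (n := n) (i := i + 1) (by omega) ha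
      have hc : Commute (T n (i + 1 + 1) : Hecke n) (descProd n i) := by
        have : ∀ m ≤ i, Commute (T n (i + 1 + 1) : Hecke n) (descProd n m) := by
          intro m hm
          induction m with
          | zero => exact Commute.one_right _
          | succ m ihm =>
            simp only [descProd, Units.val_mul]
            exact (T_comm (by omega)).mul_right (ihm (by omega))
        exact this i le_rfl
      rw [mul_assoc, mul_assoc, ← hc.eq, ← mul_assoc, ← mul_assoc, ← hb]
      simp only [mul_assoc]
    · rw [mul_assoc, ih hia' (by omega), ← mul_assoc, ← mul_assoc,
        (T_comm (n := n) (i := a + 1) (j := i) (by omega)).eq]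

theorem constHom_descProd_mul_block {x : ℕ → Rat n} {v : Rat n} {k l : ℕ} (hk : k + 1 < n)
    (hl : l ≤ k) :
    constHom n (descProd n (k + 1)) * block n x v (k + 1) l =
      block n x v k l * constHom n (descProd n (k + 1)) := by
  induction l with
  | zero => simp [block]
  | succ l ih =>
    obtain ⟨i, rfl⟩ : ∃ i, k = i + 1 + l := ⟨k - 1 - l, by omega⟩
    have e1 : i + 1 + l - l = i + 1 := by omega
    have e2 : i + 1 + l + 1 - l = i + 1 + 1 := by omega
    simp only [block, e1, e2]
    rw [← mul_assoc, ih (by omega), mul_assoc, mul_assoc, baxterT_eq, baxterT_eq, mul_add, add_mul,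
      ← map_mul, ← map_mul, descProd_mul_T (by omega) (by omega) hk, Algebra.commutes]

/-- A consequence of the Yang–Baxter equation: the spectral parameter `v` can be moved from the
right to the left of the fusion product of the variables `x_0, …, x_{k-1}`. -/
theorem blockProd_mul_block {x : ℕ → Rat n} {v : Rat n} {k : ℕ} (hk : k < n)
    (hx : ∀ i < k, x i ≠ 0 ∧ v ≠ x i) (hxx : ∀ i < k, ∀ j < i, x i ≠ x j) :
    blockProd n x 0 k * block n x v k k =
      revBlock n x v k * constHom n ((descProd n k)⁻¹ : (Hecke n)ˣ) * blockProd n x 0 k *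
        constHom n (descProd n k) := by
  induction k with
  | zero => simp [blockProd, block, revBlock, descProd]
  | succ k ih =>
    have ih := ih (by omega) (fun i hi => hx i (by omega)) fun i hi => hxx i (by omega)
    have hxk := hx k (by omega)
    have hbb := block_mul_block (x := x) hk hxk.1 hxk.2
      (fun i hi => ⟨(hx i (by omega)).1, hxx k (by omega) i hi, (hx i (by omega)).2⟩) le_rfl
    have hsh := constHom_descProd_mul_block (x := x) (v := x k) hk (le_refl k)
    have e1 : k + 1 - k = 1 := by omega
    have hc : Commute (constHom n (T n (k + 1))) (blockProd n x 0 k) :=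
      commute_blockProd (fun i _ hi => (T_comm (by omega)).map (constHom n)) x
    have hcb : Commute (baxterT n (k + 1) (x k) v) (blockProd n x 0 k) :=
      (commute_baxterT hc.symm _ _).symm
    have hD : constHom n ((descProd n (k + 1))⁻¹ : (Hecke n)ˣ) =
        constHom n ((descProd n k)⁻¹ : (Hecke n)ˣ) * constHom n ((T n (k + 1))⁻¹ : (Hecke n)ˣ) := by
      rw [← map_mul, ← Units.val_mul, descProd, mul_inv_rev]
    have hTT : constHom n ((T n (k + 1))⁻¹ : (Hecke n)ˣ) * constHom n (T n (k + 1)) = 1 := by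
      rw [← map_mul, Units.inv_mul, map_one]
    have hD' : constHom n (descProd n (k + 1)) =
        constHom n (T n (k + 1)) * constHom n (descProd n k) := by
      rw [← map_mul, ← Units.val_mul, descProd]
    simp only [blockProd, revBlock, zero_add]
    rw [show block n x v (k + 1) (k + 1) = block n x v (k + 1) k * baxterT n (k + 1 - k) (x k) v
      from rfl]
    generalize constHom n (descProd n k) = D at *
    generalize constHom n ((descProd n k)⁻¹ : (Hecke n)ˣ) = D' at *
    generalize constHom n (descProd n (k + 1)) = E at *
    generalize constHom n ((descProd n (k + 1))⁻¹ : (Hecke n)ˣ) = E' at *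
    generalize constHom n ((T n (k + 1))⁻¹ : (Hecke n)ˣ) = S' at *
    generalize constHom n (T n (k + 1)) = S at *
    generalize blockProd n x 0 k = P at *
    generalize revBlock n x v k = R at *
    generalize baxterT n (k + 1) (x k) v = B at *
    calc P * block n x (x k) k k * (block n x v (k + 1) k * baxterT n (k + 1 - k) (x k) v)
        = P * (B * block n x v k k * block n x (x k) (k + 1) k) := by
          rw [← hbb]; simp only [mul_assoc]
      _ = B * (P * block n x v k k) * block n x (x k) (k + 1) k := by
          rw [← mul_assoc, ← mul_assoc, ← hcb.eq]; simp only [mul_assoc]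
      _ = B * R * D' * (S' * S) * P * D * block n x (x k) (k + 1) k := by
          rw [ih, hTT]; simp only [mul_assoc, one_mul]
      _ = B * R * D' * S' * P * (E * block n x (x k) (k + 1) k) := by
          rw [hD']
          simp only [mul_assoc]
          rw [← mul_assoc S P, hc.eq]
          simp only [mul_assoc]
      _ = _ := by rw [hsh, hD]; simp only [mul_assoc]

theorem prod_ofFn_baxterT (x : ℕ → Rat n) (v : Rat n) (a l : ℕ) :
    (List.ofFn fun j : Fin l => baxterT n (a - j.1) (x j.1) v).prod = block n x v a l := by
  induction l with
  | zero => rfl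
  | succ l ih =>
    rw [List.ofFn_succ', List.concat_eq_append, List.prod_append, List.prod_singleton]
    exact congrArg₂ _ ih rfl

theorem prod_ofFn_block (x : ℕ → Rat n) (m : ℕ) :
    (List.ofFn fun k : Fin m => block n x (x k.1) k.1 k.1).prod = blockProd n x 0 m := by
  induction m with
  | zero => rfl
  | succ m ih =>
    rw [List.ofFn_succ', List.concat_eq_append, List.prod_append, List.prod_singleton]
    simp only [blockProd, zero_add]
    exact congrArg₂ _ ih rfl

theorem Psi_eq {x : ℕ → Rat n} (hx : ∀ k : Fin n, x k.1 = u n k) :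
    Psi n = blockProd n x 0 n * constHom n ((Tlong n n)⁻¹ : (Hecke n)ˣ) := by
  rw [Psi, ← prod_ofFn_block]
  simp only [← prod_ofFn_baxterT, hx]
  have : ∀ (k : Fin n) (j : Fin k.1), x j.1 = u n (j.castLE k.2.le) := fun k j =>
    hx (j.castLE k.2.le)
  simp only [this]
  rfl

end YangBaxter

/-! ### The fusion procedure -/

section Generic

variable {n : ℕ}

theorem rat_sub_smul (a b : Rat n) (z : RatHecke n) : (a - b) • z = a • z - b • z :=
  sub_smul a b z

theorem u_sub_algebraMap_ne_zero (m : Fin n) (a : Kq) : u n m - algebraMap Kq (Rat n) a ≠ 0 := by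
  rw [u, IsScalarTower.algebraMap_apply Kq (Poly n) (Rat n), ← map_sub]
  refine algebraMap_poly_ne_zero fun h => ?_
  have := congrArg (MvPolynomial.eval fun _ => a + 1) h
  simp at this

theorem u_ne_zero (m : Fin n) : u n m ≠ 0 := by
  have := u_sub_algebraMap_ne_zero m 0
  rwa [map_zero, sub_zero] at this

theorem u_injective : Function.Injective (u n) := fun _ _ h =>
  MvPolynomial.X_injective (IsFractionRing.injective (Poly n) (Rat n) h)

theorem qSub_u_ne_zero (m : Fin n) (a : ℤ) : qSub (u n m) a ≠ 0 := u_sub_algebraMap_ne_zero m _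

theorem revBlock_congr {x x' : ℕ → Rat n} {v : Rat n} {k : ℕ} (h : ∀ i < k, x i = x' i) :
    revBlock n x v k = revBlock n x' v k := by
  induction k with
  | zero => rfl
  | succ k ih =>
    rw [revBlock, revBlock, ih fun i hi => h i (by omega), h k (Nat.lt_succ_self k)]

theorem ScalarEval.qSub {k : Fin n} {s : Kq} {r r' : Rat n} (h : ScalarEval n k s r r') (m : ℤ) :
    ScalarEval n k s (qSub r m) (qSub r' m) :=
  h.sub (ScalarEval.constant _)

theorem algebraMap_qSub (s : Kq) (m : ℤ) :
    qSub (algebraMap Kq (Rat n) s) m = algebraMap Kq (Rat n) (qSub s m) := by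
  rw [qSub, qSub, map_sub]; rfl

theorem algebraMap_addFactor (mu : YoungDiagram) (c : ℕ × ℕ) (s : Kq) :
    addFactor mu c (algebraMap Kq (Rat n) s) = algebraMap Kq (Rat n) (addFactor mu c s) := by
  simp only [addFactor, algebraMap_qSub, map_mul, map_prod, map_div₀]

theorem ScalarEval.addFactor {k : Fin n} {mu : YoungDiagram} {c : ℕ × ℕ} (hc : c ∈ addable mu)
    {r : Rat n} (h : ScalarEval n k (qContent c) r (algebraMap Kq (Rat n) (qContent c))) :
    ScalarEval n k (qContent c) (addFactor mu c r)
      (algebraMap Kq (Rat n) (addFactor mu c (qContent c))) := by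
  obtain ⟨h1, h2⟩ := qSub_qContent_ne_zero hc
  rw [← algebraMap_addFactor]
  refine (ScalarEval.prod fun i hi => ?_).mul (ScalarEval.prod fun j hj => ?_)
  · refine (h.qSub _).div (h.qSub _) ?_
    rw [algebraMap_qSub, map_ne_zero]
    exact h1 i (Finset.mem_range.1 hi)
  · refine (h.qSub _).div (h.qSub _) ?_
    rw [algebraMap_qSub, map_ne_zero]
    exact h2 j (Finset.mem_range.1 hj)

/-- The computation behind the induction for the resolvent identity: here `V` and `E` are the
idempotents of consecutive tableaux, `H` is the product of Baxterized generators for `V`, and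
`K` is the resolvent `(u - y)⁻¹ V`. -/
theorem resolvent_step {R A : Type*} [Field R] [Ring A] [Algebra R A]
    {V E H K a a' y Y : A} {u s t e g : R}
    (hH : H * V = s • K) (hK : K * (u • 1 - y) = V) (hVE : V * E = E)
    (hEE : E * E = E) (hyE : y * E = t • E) (hEY : Commute E Y) (haV : Commute a' V)
    (ha : a = a' + e • 1) (haa : a * a' = 1) (hY : a' * Y = y * a) (hg : g * (u - t) = e * t)
    (hut : u - t ≠ 0) (hE : E * ((a + g • 1) * H * a' * E) = (a + g • 1) * H * a' * E) :
    (a + g • 1) * H * a' * E * (u • 1 - Y) = (s * (1 - g * e - g ^ 2)) • E := by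
  have hKE : K * E = (u - t)⁻¹ • E := by
    have h1 : K * ((u • 1 - y) * E) = E := by rw [← mul_assoc, hK, hVE]
    rw [sub_mul, hyE, smul_mul_assoc, one_mul, ← sub_smul, mul_smul_comm] at h1
    rw [eq_inv_smul_iff₀ hut, h1]
  have hHa : H * a' * E = s • (K * a' * E) := by
    calc H * a' * E = H * (a' * V) * E := by rw [mul_assoc H (a' * V), mul_assoc a', hVE, mul_assoc]
      _ = (H * V) * (a' * E) := by rw [haV.eq]; simp only [mul_assoc]
      _ = s • (K * a' * E) := by rw [hH, smul_mul_assoc, mul_assoc K]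
  have h2 : K * a' * (u • 1 - Y) * E = a' * E - g • E := by
    have h3 : a' * (u • 1 - Y) = (u • 1 - y) * a' - e • y := by
      rw [mul_sub, hY, ha, mul_add, sub_mul]
      simp only [mul_smul_comm, smul_mul_assoc, mul_one, one_mul]
      abel
    have h4 : g = e * t * (u - t)⁻¹ := by rw [← hg, mul_inv_cancel_right₀ hut]
    calc K * a' * (u • 1 - Y) * E = K * (a' * (u • 1 - Y)) * E := by rw [mul_assoc K]
      _ = K * (u • 1 - y) * a' * E - e • (K * (y * E)) := by
          rw [h3, mul_sub, sub_mul, mul_smul_comm, smul_mul_assoc, ← mul_assoc, ← mul_assoc K y]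
      _ = a' * (V * E) - e • t • (u - t)⁻¹ • E := by
          rw [hK, hyE, mul_smul_comm, hKE, ← haV.eq, mul_assoc]
      _ = a' * E - g • E := by rw [hVE, h4, smul_smul, smul_smul]
  have haa' : (a + g • 1) * (a' * E - g • E) = (1 - g * e - g ^ 2) • E := by
    have h5 : a * (a' * E) = E := by rw [← mul_assoc, haa, one_mul]
    have h6 : a * E = a' * E + e • E := by rw [ha, add_mul, smul_mul_assoc, one_mul]
    rw [mul_sub, add_mul, add_mul, h5, smul_mul_assoc, one_mul, mul_smul_comm, h6,
      smul_mul_assoc, one_mul]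
    module
  have hcomm : Commute E (u • 1 - Y) := ((Commute.one_right E).smul_right u).sub_right hEY
  calc (a + g • 1) * H * a' * E * (u • 1 - Y)
      = E * ((a + g • 1) * (H * a' * E)) * (u • 1 - Y) := by
        rw [← hE]; simp only [mul_assoc]
    _ = s • (E * ((a + g • 1) * (K * a' * (E * (u • 1 - Y))))) := by
        rw [hHa]; simp only [mul_smul_comm, smul_mul_assoc, mul_assoc]
    _ = s • (E * ((a + g • 1) * (K * a' * (u • 1 - Y) * E))) := by
        rw [hcomm.eq]; simp only [mul_assoc]
    _ = _ := by rw [h2, haa', mul_smul_comm, hEE, smul_smul]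

end Generic

namespace StandardTableau

variable {n : ℕ} {lam : YoungDiagram} (t : StandardTableau n lam)

/-- The arguments of `Ψ` after the first `j` evaluations: `σ_m` for the first `j` of them and the
variable `u_m` for the others. -/
def point (j m : ℕ) : Rat n :=
  if h : m < n then
    if m < j then algebraMap Kq (Rat n) (t.sigma ⟨m, h⟩) else u n ⟨m, h⟩
  else 0

theorem point_of_lt {j m : ℕ} (hm : m < n) (h : m < j) :
    t.point j m = algebraMap Kq (Rat n) (t.sigma ⟨m, hm⟩) := by
  rw [point, dif_pos hm, if_pos h]

theorem point_of_le {j m : ℕ} (hm : m < n) (h : j ≤ m) : t.point j m = u n ⟨m, hm⟩ := by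
  rw [point, dif_pos hm, if_neg (by omega)]

theorem sigma_ne_zero (k : Fin n) : t.sigma k ≠ 0 := qContent_ne_zero _

theorem point_ne_zero {j m : ℕ} (hm : m < n) : t.point j m ≠ 0 := by
  rcases lt_or_ge m j with h | h
  · rw [t.point_of_lt hm h, map_ne_zero]; exact t.sigma_ne_zero _
  · rw [t.point_of_le hm h]; exact u_ne_zero _

theorem point_ne_point {j i m : ℕ} (hm : m < n) (him : i < m) (hj : j ≤ m) :
    t.point j i ≠ t.point j m := by
  rw [t.point_of_le hm hj]
  rcases lt_or_ge i j with h | h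
  · rw [t.point_of_lt (by omega) h]
    exact fun h => u_sub_algebraMap_ne_zero ⟨m, hm⟩ _ (sub_eq_zero.2 h.symm)
  · rw [t.point_of_le (by omega) h]
    intro h
    have := congrArg Fin.val (u_injective h)
    simp only at this
    omega

theorem scalarEval_point {j : ℕ} (hj : j < n) (m : ℕ) :
    ScalarEval n ⟨j, hj⟩ (t.sigma ⟨j, hj⟩) (t.point j m) (t.point (j + 1) m) := by
  by_cases hm : m < n
  · rcases lt_trichotomy m j with h | rfl | h
    · rw [t.point_of_lt hm h, t.point_of_lt hm (by omega)]
      exact ScalarEval.constant _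
    · rw [t.point_of_le hm le_rfl, t.point_of_lt hm (by omega)]
      exact ScalarEval.u_self
    · rw [t.point_of_le hm h.le, t.point_of_le hm h]
      exact ScalarEval.u_of_ne fun h' => h.ne' (congrArg Fin.val h')
  · rw [point, dif_neg hm, point, dif_neg hm]
    simpa using ScalarEval.constant (n := n) (k := ⟨j, hj⟩) (s := t.sigma ⟨j, hj⟩) 0

theorem evaluatesTo_baxterT_point {j a m : ℕ} (i : ℕ) (ham : a < m) (hjm : j < m) (hm : m < n) :
    EvaluatesTo n ⟨j, by omega⟩ (t.sigma ⟨j, by omega⟩)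
      (baxterT n i (t.point j a) (t.point j m))
      (baxterT n i (t.point (j + 1) a) (t.point (j + 1) m)) :=
  evaluatesTo_baxterT i (t.scalarEval_point _ a) (t.scalarEval_point _ m)
    (t.point_ne_zero (by omega)) (t.point_ne_point hm ham hjm)

theorem evaluatesTo_block {j m : ℕ} (a l : ℕ) (hl : l ≤ m) (hjm : j < m) (hm : m < n) :
    EvaluatesTo n ⟨j, by omega⟩ (t.sigma ⟨j, by omega⟩)
      (block n (t.point j) (t.point j m) a l)
      (block n (t.point (j + 1)) (t.point (j + 1) m) a l) := by
  induction l with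
  | zero => simpa [block, const_eq_constHom] using EvaluatesTo.const (n := n) (1 : Hecke n)
  | succ l ih => exact (ih (by omega)).mul (t.evaluatesTo_baxterT_point _ (by omega) hjm hm)

theorem evaluatesTo_revBlock {j m : ℕ} (k : ℕ) (hk : k ≤ m) (hjm : j < m) (hm : m < n) :
    EvaluatesTo n ⟨j, by omega⟩ (t.sigma ⟨j, by omega⟩)
      (revBlock n (t.point j) (t.point j m) k)
      (revBlock n (t.point (j + 1)) (t.point (j + 1) m) k) := by
  induction k with
  | zero => simpa [revBlock, const_eq_constHom] using EvaluatesTo.const (n := n) (1 : Hecke n)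
  | succ k ih => exact (t.evaluatesTo_baxterT_point _ (by omega) hjm hm).mul (ih (by omega))

/-- The value of the fusion product of the first `j` variables at the contents of `t`. -/
def fusedValue (j : ℕ) : Hecke n :=
  (normFactor (t.shape j))⁻¹ • (t.idemAux j * Tlong n j)

/-- The fusion product of the first `j + l` variables after the first `j` evaluations. -/
def partialFusion (j l : ℕ) : RatHecke n :=
  constHom n (t.fusedValue j) * blockProd n (t.point j) j l

/-- The exchange relation of `blockProd_mul_block` for the partially evaluated product. -/
def Exchange (j l : ℕ) : Prop :=
  ∀ m, j + l ≤ m → m < n →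
    t.partialFusion j l * block n (t.point j) (t.point j m) (j + l) (j + l) =
      revBlock n (t.point j) (t.point j m) (j + l) *
        constHom n ((descProd n (j + l))⁻¹ : (Hecke n)ˣ) * t.partialFusion j l *
          constHom n (descProd n (j + l))

/-- The product of Baxterized generators `T_j(σ_{j-1}, v) ⋯ T_1(σ_0, v) T_1⁻¹ ⋯ T_j⁻¹`. -/
def dressed (j : ℕ) (v : Rat n) : RatHecke n :=
  revBlock n (t.point j) v j * constHom n ((descProd n j)⁻¹ : (Hecke n)ˣ)

/-- The product `dressed j u_m` agrees with the resolvent `(u_m - y_{j+1})⁻¹` on the idempotent of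
the first `j` entries, up to the scalar `contentProd`. -/
def Resolvent (j : ℕ) : Prop :=
  ∀ (m : ℕ) (hm : m < n), j ≤ m →
    t.dressed j (u n ⟨m, hm⟩) * constHom n (t.idemAux j) *
        (u n ⟨m, hm⟩ • 1 - constHom n (jm n (j + 1))) =
      contentProd (t.shape j) (u n ⟨m, hm⟩) • constHom n (t.idemAux j)

/-- The spectral decomposition of `(v - y_{j+1})⁻¹` on the idempotent of the first `j` entries. -/
def spectralSum (j : ℕ) (v : Rat n) : RatHecke n :=
  ∑ c ∈ addable (t.shape j), (v - algebraMap Kq (Rat n) (qContent c))⁻¹ • constHom n (t.branch j c)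

theorem sub_jm_mul_spectralSum {j m : ℕ} (hj : j < n) (hm : m < n) :
    (u n ⟨m, hm⟩ • 1 - constHom n (jm n (j + 1))) * t.spectralSum j (u n ⟨m, hm⟩) =
      constHom n (t.idemAux j) := by
  rw [← t.sum_branch j, map_sum, spectralSum, Finset.mul_sum]
  refine Finset.sum_congr rfl fun c hc => ?_
  have h0 := u_sub_algebraMap_ne_zero ⟨m, hm⟩ (qContent c)
  rw [mul_smul_comm, sub_mul, smul_mul_assoc, one_mul, ← map_mul,
    t.jm_mul_branch hj (t.wt_idemAux hj.le) hc, constHom_smul, ← rat_sub_smul, inv_smul_smul₀ h0]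

theorem jm_commute_branch {i j : ℕ} (hi : i ≤ n) (hj : j < n) (c : ℕ × ℕ) :
    Commute (jm n i) (t.branch j c) :=
  (t.jm_commute_idemAux hi hj.le).mul_right (commute_aeval (jm_commute hi hj) _)

theorem spectralSum_mul_sub_jm {j m : ℕ} (hj : j < n) (hm : m < n) :
    t.spectralSum j (u n ⟨m, hm⟩) * (u n ⟨m, hm⟩ • 1 - constHom n (jm n (j + 1))) =
      constHom n (t.idemAux j) := by
  rw [← t.sub_jm_mul_spectralSum hj hm]
  refine (Commute.eq ?_)
  rw [spectralSum]
  refine (Commute.sum_left _ _ _ fun c _ => ?_)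
  refine Commute.smul_left ?_ _
  exact ((Commute.one_right _).smul_right _).sub_right
    ((t.jm_commute_branch hj hj c).symm.map (constHom n))

theorem idemAux_mul_spectralSum {j : ℕ} (hj : j < n) (v : Rat n) :
    constHom n (t.idemAux j) * t.spectralSum j v = t.spectralSum j v := by
  rw [spectralSum, Finset.mul_sum]
  refine Finset.sum_congr rfl fun c _ => ?_
  rw [mul_smul_comm, ← map_mul, branch, ← mul_assoc, t.idemAux_mul_self hj.le]

variable {t}

/-- The resolvent identity in solved form; `spectralSum` replaces the inverse of `u_m - y_{j+1}`. -/
theorem Resolvent.dressed_mul {j : ℕ} (h : t.Resolvent j) {m : ℕ} (hm : m < n) (hjm : j ≤ m) :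
    t.dressed j (u n ⟨m, hm⟩) * constHom n (t.idemAux j) =
      contentProd (t.shape j) (u n ⟨m, hm⟩) • t.spectralSum j (u n ⟨m, hm⟩) := by
  have h1 := congrArg (· * t.spectralSum j (u n ⟨m, hm⟩)) (h m hm hjm)
  rwa [mul_assoc, t.sub_jm_mul_spectralSum (by omega) hm, mul_assoc, ← map_mul,
    t.idemAux_mul_self (by omega), smul_mul_assoc, t.idemAux_mul_spectralSum (by omega)] at h1

theorem Exchange.fusedValue {j : ℕ} (h : t.Exchange j 0) {m : ℕ} (hm : m < n) (hjm : j ≤ m) :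
    constHom n (t.fusedValue j) * block n (t.point j) (u n ⟨m, hm⟩) j j =
      t.dressed j (u n ⟨m, hm⟩) * constHom n (t.fusedValue j) * constHom n (descProd n j) := by
  have := h m hjm hm
  rw [t.point_of_le hm hjm] at this
  simpa only [partialFusion, blockProd, mul_one, add_zero, dressed] using this

/-- The exchange relation implies that `dressed j u_m` maps the image of the idempotent to
itself. -/
theorem Exchange.idemAux_mul {j : ℕ} (h : t.Exchange j 0) {m : ℕ} (hm : m < n) (hjm : j ≤ m) :
    constHom n (t.idemAux j) * (t.dressed j (u n ⟨m, hm⟩) * constHom n (t.idemAux j)) =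
      t.dressed j (u n ⟨m, hm⟩) * constHom n (t.idemAux j) := by
  have h1 := h.fusedValue hm hjm
  have hf : (algebraMap Kq (Rat n) (normFactor (t.shape j))⁻¹) ≠ 0 := by
    rw [map_ne_zero]; exact inv_ne_zero (normFactor_ne_zero _)
  rw [StandardTableau.fusedValue, constHom_smul, map_mul, smul_mul_assoc, mul_smul_comm,
    smul_mul_assoc] at h1
  have h2 := smul_right_injective _ hf h1
  have hE : constHom n (t.idemAux j) * constHom n (t.idemAux j) = constHom n (t.idemAux j) := by
    rw [← map_mul, t.idemAux_mul_self (by omega)]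
  -- `h2` shows that the right-hand side is the idempotent times some element.
  have h3 : t.dressed j (u n ⟨m, hm⟩) * constHom n (t.idemAux j) =
      constHom n (t.idemAux j) * (constHom n (Tlong n j) *
        block n (t.point j) (u n ⟨m, hm⟩) j j *
          constHom n ((descProd n j)⁻¹ : (Hecke n)ˣ) *
            constHom n ((Tlong n j)⁻¹ : (Hecke n)ˣ)) := by
    have h4 := congrArg (· * (constHom n ((descProd n j)⁻¹ : (Hecke n)ˣ) *
      constHom n ((Tlong n j)⁻¹ : (Hecke n)ˣ))) h2
    have e1 : ∀ (w : (Hecke n)ˣ) (z : RatHecke n),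
        constHom n w * (constHom n (w⁻¹ : (Hecke n)ˣ) * z) = z := fun w z => by
      rw [← mul_assoc, ← map_mul, Units.mul_inv, map_one, one_mul]
    have e2 : ∀ w : (Hecke n)ˣ, constHom n w * constHom n (w⁻¹ : (Hecke n)ˣ) = 1 := fun w => by
      rw [← map_mul, Units.mul_inv, map_one]
    simp only [mul_assoc, e1, e2, mul_one] at h4
    simp only [mul_assoc]
    exact h4.symm
  rw [h3, ← mul_assoc, hE]

variable (t)

theorem resolvent_zero : t.Resolvent 0 := by
  intro m hm _
  have h1 : jm n (0 + 1) = 1 := rfl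
  rw [dressed, revBlock, idemAux, h1, shape_zero, contentProd_bot]
  simp [descProd, rat_sub_smul]

theorem exchange_zero (l : ℕ) : t.Exchange 0 l := by
  intro m hlm hm
  have h1 : t.partialFusion 0 l = blockProd n (t.point 0) 0 l := by
    rw [partialFusion, fusedValue, shape_zero, idemAux]
    simp [Tlong, normFactor]
  rw [h1, zero_add]
  refine blockProd_mul_block (by omega) (fun i hi => ⟨t.point_ne_zero (by omega), ?_⟩)
    fun i hi j hj => ?_
  · exact (t.point_ne_point hm (by omega) (Nat.zero_le _)).symm
  · exact (t.point_ne_point (by omega) hj (Nat.zero_le _)).symm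

variable {t}

/-- The first of the remaining variables can be evaluated in its block. -/
theorem Resolvent.evaluatesTo {j : ℕ} (h : t.Resolvent j) (hx : t.Exchange j 0) (hj : j < n) :
    EvaluatesTo n ⟨j, hj⟩ (t.sigma ⟨j, hj⟩) (t.partialFusion j 1) (t.partialFusion (j + 1) 0) := by
  have hadd := t.isAdd_shape hj
  set c₀ := (t.cell ⟨j, hj⟩).1
  set v := u n ⟨j, hj⟩ with hv
  have hvs : ScalarEval n ⟨j, hj⟩ (qContent c₀) v (algebraMap Kq (Rat n) (qContent c₀)) :=
    ScalarEval.u_self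
  have hL : t.partialFusion j 1 = ∑ c ∈ addable (t.shape j),
      algebraMap (Rat n) (RatHecke n) (algebraMap Kq (Rat n) (normFactor (t.shape j))⁻¹ *
        (contentProd (t.shape j) v * (v - algebraMap Kq (Rat n) (qContent c))⁻¹)) *
        const n (t.branch j c * Tlong n (j + 1)) := by
    have h1 : t.partialFusion j 1 = constHom n (t.fusedValue j) * block n (t.point j) v j j := by
      rw [partialFusion, blockProd, blockProd, one_mul, add_zero, t.point_of_le hj le_rfl]
    rw [h1, hx.fusedValue hj le_rfl, fusedValue, constHom_smul, map_mul, mul_smul_comm,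
      ← mul_assoc, h.dressed_mul hj le_rfl, spectralSum, Finset.smul_sum, Finset.sum_mul,
      Finset.smul_sum, Finset.sum_mul]
    refine Finset.sum_congr rfl fun c _ => ?_
    rw [← Algebra.smul_def, const_eq_constHom, Tlong, Units.val_mul, map_mul, map_mul, mul_smul,
      mul_smul]
    simp only [smul_mul_assoc, mul_assoc]
    rfl
  have hR : t.partialFusion (j + 1) 0 = ∑ c ∈ addable (t.shape j),
      algebraMap (Rat n) (RatHecke n) (algebraMap Kq (Rat n) (normFactor (t.shape j))⁻¹ *
        (if c = c₀ then algebraMap Kq (Rat n) (addFactor (t.shape j) c₀ (qContent c₀)) else 0)) *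
        const n (t.branch j c * Tlong n (j + 1)) := by
    rw [Finset.sum_eq_single_of_mem c₀ hadd.mem_addable
      fun c _ hc => by rw [if_neg hc, mul_zero, map_zero, zero_mul]]
    have hnf : (normFactor (t.shape (j + 1)))⁻¹ =
        (normFactor (t.shape j))⁻¹ * addFactor (t.shape j) c₀ (qContent c₀) := by
      have h1 := hadd.normFactor
      have h2 := normFactor_ne_zero (t.shape j)
      have h3 := normFactor_ne_zero (t.shape (j + 1))
      rw [← h1, mul_inv]
      have h4 : addFactor (t.shape j) c₀ (qContent c₀) ≠ 0 := fun h0 => h2 (by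
        rw [← h1, h0, mul_zero])
      rw [inv_mul_cancel_right₀ h4]
    rw [if_pos rfl, ← map_mul, ← Algebra.smul_def, partialFusion, blockProd, mul_one, fusedValue,
      constHom_smul, hnf, t.idemAux_succ hj, const_eq_constHom]
  rw [hL, hR]
  -- At `v = σ` the scalar `contentProd / (v - σ_c)` tends to `addFactor` for the next cell of `t`
  -- and to `0` for the other addable cells.
  refine EvaluatesTo.sum fun c hc => ?_
  refine (ScalarEval.evaluatesTo ?_).mul (EvaluatesTo.const _)
  refine (ScalarEval.constant _).mul ?_
  have hcp := contentProd_eq hadd.mem_addable (u := v) (qSub_u_ne_zero _)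
  have hq : qSub v (content c₀) = v - algebraMap Kq (Rat n) (qContent c₀) := rfl
  rw [hq] at hcp
  have h0 := u_sub_algebraMap_ne_zero (n := n) ⟨j, hj⟩ (qContent c)
  by_cases hcc : c = c₀
  · subst hcc
    rw [if_pos rfl, hcp, mul_assoc, mul_comm, mul_assoc, inv_mul_cancel₀ h0, mul_one]
    exact ScalarEval.addFactor hadd.mem_addable hvs
  · have h1 := ((hvs.sub (ScalarEval.constant (qContent c₀))).mul
      (ScalarEval.addFactor hadd.mem_addable hvs)).mul
        ((hvs.sub (ScalarEval.constant (qContent c))).inv (by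
          rw [← map_sub, map_ne_zero, sub_ne_zero]
          exact fun h => hcc (addable_qContent_injOn _ hadd.mem_addable hc h).symm))
    rw [sub_self, zero_mul, zero_mul, ← hcp] at h1
    rw [if_neg hcc]
    exact h1

theorem Resolvent.evaluatesTo_partialFusion {j : ℕ} (h : t.Resolvent j) (hx : t.Exchange j 0)
    (hj : j < n) (l : ℕ) (hl : j + 1 + l ≤ n) :
    EvaluatesTo n ⟨j, hj⟩ (t.sigma ⟨j, hj⟩) (t.partialFusion j (l + 1))
      (t.partialFusion (j + 1) l) := by
  induction l with
  | zero => exact h.evaluatesTo hx hj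
  | succ l ih =>
    have h1 := (ih (by omega)).mul
      (t.evaluatesTo_block (j := j) (m := j + 1 + l) (j + 1 + l) (j + 1 + l) le_rfl (by omega)
        (by omega))
    have e : j + (l + 1) = j + 1 + l := by omega
    have h2 : t.partialFusion j (l + 1 + 1) = t.partialFusion j (l + 1) *
        block n (t.point j) (t.point j (j + 1 + l)) (j + 1 + l) (j + 1 + l) := by
      rw [partialFusion, blockProd, ← mul_assoc, e]; rfl
    have h3 : t.partialFusion (j + 1) (l + 1) = t.partialFusion (j + 1) l *
        block n (t.point (j + 1)) (t.point (j + 1) (j + 1 + l)) (j + 1 + l) (j + 1 + l) := by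
      rw [partialFusion, blockProd, ← mul_assoc]; rfl
    rw [h2, h3]
    exact h1

/-- Both sides of the exchange relation can be evaluated at the next variable, and values are
unique. -/
theorem Resolvent.exchange_succ {j : ℕ} (h : t.Resolvent j) (hx : ∀ l, t.Exchange j l) (l : ℕ) :
    t.Exchange (j + 1) l := by
  intro m hlm hm
  have hj : j < n := by omega
  have h1 := h.evaluatesTo_partialFusion (hx 0) hj l (by omega)
  have h2 := hx (l + 1) m (by omega) hm
  rw [show j + (l + 1) = j + 1 + l by omega] at h2
  have hL := h1.mul (t.evaluatesTo_block (j + 1 + l) (j + 1 + l) hlm (by omega) hm)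
  have hR := (((t.evaluatesTo_revBlock (j + 1 + l) hlm (by omega) hm).mul
    (EvaluatesTo.const ((descProd n (j + 1 + l))⁻¹ : (Hecke n)ˣ))).mul h1).mul
      (EvaluatesTo.const (descProd n (j + 1 + l)))
  rw [h2] at hL
  exact hL.unique hR

theorem Resolvent.succ {j : ℕ} (h : t.Resolvent j) (hx : t.Exchange (j + 1) 0) :
    t.Resolvent (j + 1) := by
  intro m hm hjm
  have hj : j + 1 < n := by omega
  set v := u n ⟨m, hm⟩ with hv
  set s := algebraMap Kq (Rat n) (t.sigma ⟨j, by omega⟩) with hs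
  have hs0 : s ≠ 0 := by rw [hs, map_ne_zero]; exact t.sigma_ne_zero _
  have hvs : v - s ≠ 0 := u_sub_algebraMap_ne_zero _ _
  have hdr : t.dressed (j + 1) v =
      (constHom n (T n (j + 1)) + baxterScalar n s v • 1) * t.dressed j v *
        constHom n ((T n (j + 1))⁻¹ : (Hecke n)ˣ) := by
    have e1 : revBlock n (t.point (j + 1)) v j = revBlock n (t.point j) v j :=
      revBlock_congr fun i hi => by
        rw [t.point_of_lt (by omega) (by omega), t.point_of_lt (by omega) hi]
    rw [dressed, revBlock, e1, t.point_of_lt (m := j) (by omega) (by omega), ← hs, baxterT_eq,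
      Algebra.algebraMap_eq_smul_one, descProd, mul_inv_rev, Units.val_mul, map_mul, dressed]
    simp only [mul_assoc]
  have hidem := hx.idemAux_mul hm hjm
  rw [← hv, hdr] at hidem
  have hstep := resolvent_step (R := Rat n) (A := RatHecke n)
    (V := constHom n (t.idemAux j)) (E := constHom n (t.idemAux (j + 1)))
    (H := t.dressed j v) (K := t.spectralSum j v) (a := constHom n (T n (j + 1)))
    (a' := constHom n ((T n (j + 1))⁻¹ : (Hecke n)ˣ)) (y := constHom n (jm n (j + 1)))
    (Y := constHom n (jm n (j + 1 + 1))) (u := v) (s := contentProd (t.shape j) v) (t := s)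
    (e := algebraMap Kq (Rat n) eta) (g := baxterScalar n s v)
    (h.dressed_mul hm (by omega)) (t.spectralSum_mul_sub_jm (by omega) hm)
    (by rw [← map_mul, t.idemAux_mul_succ (by omega)])
    (by rw [← map_mul, t.idemAux_mul_self (by omega)])
    (by rw [← map_mul, t.jm_mul_idemAux (by omega) (Nat.lt_succ_self j), constHom_smul])
    ((t.jm_commute_idemAux (by omega) (by omega)).symm.map (constHom n))
    (by
      refine Commute.map ?_ (constHom n)
      exact Commute.units_inv_left
        (t.commute_idemAux (by omega) fun i _ hi => T_comm (by omega)))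
    (by rw [T_inv (by omega) hj, map_sub, constHom_smul, map_one, sub_add_cancel])
    (by rw [← map_mul, Units.mul_inv, map_one])
    (by rw [← map_mul, ← map_mul, jm_succ (by omega), mul_assoc, Units.inv_mul_cancel_left])
    (by rw [baxterScalar_eq hs0, div_mul_cancel₀ _ hvs]) hvs hidem
  rw [hdr, hstep, (t.isAdd_shape (show j < n by omega)).contentProd]
  congr 2
  have hc : ∀ e : ℤ, qSub v (content (t.cell ⟨j, by omega⟩).1 + e) =
      v - algebraMap Kq (Rat n) (q ^ (2 * e)) * s := by
    intro e
    rw [qSub, hs, ← map_mul, sigma, qContent, ← zpow_add₀ q_ne_zero]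
    congr 3; ring
  have hc0 := hc 0
  have hcm := hc (-1)
  rw [mul_zero, zpow_zero, map_one, one_mul, add_zero] at hc0
  rw [← sub_eq_add_neg] at hcm
  rw [hc0, hcm, hc 1, baxterScalar_eq hs0, eta, map_sub]
  have e1 : algebraMap Kq (Rat n) (q ^ (2 * 1 : ℤ)) =
      algebraMap Kq (Rat n) q * algebraMap Kq (Rat n) q := by
    rw [mul_one, zpow_two, map_mul]
  have e2 : algebraMap Kq (Rat n) (q ^ (2 * (-1) : ℤ)) =
      algebraMap Kq (Rat n) q⁻¹ * algebraMap Kq (Rat n) q⁻¹ := by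
    rw [mul_neg, mul_one, zpow_neg, zpow_two, mul_inv, map_mul]
  rw [e1, e2]
  have hqq : algebraMap Kq (Rat n) q * algebraMap Kq (Rat n) q⁻¹ = 1 := by
    rw [← map_mul, mul_inv_cancel₀ q_ne_zero, map_one]
  generalize algebraMap Kq (Rat n) q = p at *
  generalize algebraMap Kq (Rat n) q⁻¹ = p' at *
  field_simp
  linear_combination (-s ^ 2 * (p * p' + 1) + 2 * v * s) * hqq

variable (t)

theorem resolvent_and_exchange (j : ℕ) : t.Resolvent j ∧ ∀ l, t.Exchange j l := by
  induction j with
  | zero => exact ⟨t.resolvent_zero, t.exchange_zero⟩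
  | succ j ih =>
    have h := ih.1.exchange_succ ih.2
    exact ⟨ih.1.succ (h 0), h⟩

end StandardTableau

end HeckeFusion

end

theorem theorem1 (n : ℕ) (lam : YoungDiagram) (t : HeckeFusion.StandardTableau n lam) :
    ∃ Phi : Fin (n + 1) → HeckeFusion.RatHecke n,
      Phi 0 = HeckeFusion.Psi n ∧
      (∀ k : Fin n, HeckeFusion.EvaluatesTo n k (t.sigma k) (Phi k.castSucc) (Phi k.succ)) ∧
      HeckeFusion.const n t.idem = HeckeFusion.normFactor lam • Phi (Fin.last n) := by
  -- After `k` evaluations the product is the fused value of the first `k` variables times the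
  -- blocks of the remaining ones.
  refine ⟨fun k => t.partialFusion k.1 (n - k.1) *
    HeckeFusion.const n ((HeckeFusion.Tlong n n)⁻¹ : (HeckeFusion.Hecke n)ˣ), ?_, fun k => ?_, ?_⟩
  · rw [HeckeFusion.Psi_eq (x := t.point 0) fun k => t.point_of_le k.2 (Nat.zero_le _)]
    have h1 : t.fusedValue 0 = 1 := by
      rw [HeckeFusion.StandardTableau.fusedValue, t.shape_zero, HeckeFusion.StandardTableau.idemAux]
      simp [HeckeFusion.Tlong, HeckeFusion.normFactor]
    simp only [HeckeFusion.StandardTableau.partialFusion, Fin.val_zero, Nat.sub_zero, h1,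
      map_one, one_mul]
    rfl
  · obtain ⟨h1, h2⟩ := t.resolvent_and_exchange k.1
    refine HeckeFusion.EvaluatesTo.mul ?_ (HeckeFusion.EvaluatesTo.const _)
    have h3 := h1.evaluatesTo_partialFusion (h2 0) k.2 (n - (k.1 + 1)) (by omega)
    rw [show n - (k.1 + 1) + 1 = n - k.1 by omega] at h3
    exact h3
  · have h1 : t.partialFusion n (n - n) = HeckeFusion.constHom n (t.fusedValue n) := by
      rw [Nat.sub_self, HeckeFusion.StandardTableau.partialFusion, HeckeFusion.blockProd, mul_one]
    simp only [Fin.val_last, h1]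
    rw [HeckeFusion.StandardTableau.fusedValue, t.shape_self, HeckeFusion.const_eq_constHom,
      HeckeFusion.const_eq_constHom, ← map_mul, ← map_smul, smul_mul_assoc, smul_smul,
      mul_inv_cancel₀ (HeckeFusion.normFactor_ne_zero lam), one_smul, mul_assoc, Units.mul_inv,
      mul_one]
    rfl
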